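/- Fix integers $p,D_u,D_i\ge 0$, reals $\beta>0$, $M\ge 0$ and $d_u,d_i\ge 0$. Let $\mu_{ui}$ be the joint law of a pair of covariates $(x_u,\tilde x_i)$, with marginal laws $\mu_u$ and $\mu_i$ supported in $[0,1]^{D_u}$ and $[0,1]^{D_i}$. **Notation.** - For $S\subset\mathbb R^D$ let $\mathcal N(r,S)$ be the least number of $\|\cdot\|_\infty$-balls of radius $r$ that cover $S$, and let $\dim S=\inf\{d\ge 0 : \limsup_{r\to 0}\mathcal N(r,S)\,r^{d}=0\}$ be its upper Minkowski dimension. - $\mathcal H(\beta,[0,1]^D,M)$ is the set of $f\in C^{\lfloor\beta\rfloor}([0,1]^D)$ with $$\max_{\|\alpha\|_1<\beta}\ \sup_{x}|\partial^\alpha f(x)|+\max_{\|\alpha\|_1=\lfloor\beta\rfloor}\ \sup_{x\ne x'}\frac{|\partial^\alpha f(x)-\partial^\alpha f(x')|}{\|x-x'\|_\infty^{\beta-\lfloor\beta\rfloor}}\le M .$$ - $\mathcal F_D(W,L,B,M)$ is the set of functions $f:\mathbb R^D\to\mathbb R^p$ computed by a fully connected ReLU network (hidden layers $x\mapsto\max(Ax+b,0)$,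 last layer affine, arbitrary widths) with at most $L$ layers, at most $W$ nonzero entries in all its weight matrices and bias vectors, and all of these entries at most $B$ in absolute value, such that $|f_j(x)|\le 2M$ for all $x\in[0,1]^D$ and all $j=1,\dots,p$. - For $\Phi=(W,L,B,M,\tilde W,\tilde L,\tilde B)$, $\mathcal R^\Phi$ is the set of functions $R(x,\tilde x)=\langle f(x),\tilde f(\tilde x)\rangle$ with $f\in\mathcal F_{D_u}(W,L,B,M)$ and $\tilde f\in\mathcal F_{D_i}(\tilde W,\tilde L,\tilde B,M)$. - $\|g\|_{L^\infty(\mu)}=\sup_{z\in\mathrm{Supp}(\mu)}|g(z)|$. **Theorem 1.** Suppose that $\dim(\mathrm{Supp}(\mu_u))\le d_u$ and $\dim(\mathrm{Supp}(\mu_i))\le d_i$. In the critical case $\dim(\mathrm{Supp}(\mu_u))=d_u$ suppose in addition that $\limsup_{r\to0}\mathcal N(r,\mathrm{Supp}(\mu_u))\,r^{d_u}<\infty$, and likewise for $\mu_i$ in the case $\dim(\mathrm{Supp}(\mu_i))=d_i$. Then there are constants $C$, $s>0$ and depths $L,\tilde L$ such that for every $\epsilon>0$ there is $\Phi=(W,L,B,M,\tilde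 W,\tilde L,\tilde B)$ with $$W\le C\epsilon^{-d_u/\beta},\qquad \tilde W\le C\epsilon^{-d_i/\beta},\qquad B\le C\epsilon^{-s},\qquad \tilde B\le C\epsilon^{-s}$$ such that, for all $f^*:[0,1]^{D_u}\to\mathbb R^p$ and $\tilde f^*:[0,1]^{D_i}\to\mathbb R^p$ whose coordinates lie in $\mathcal H(\beta,[0,1]^{D_u},M)$ and $\mathcal H(\beta,[0,1]^{D_i},M)$ respectively, the function $R^*(x,\tilde x)=\langle f^*(x),\tilde f^*(\tilde x)\rangle$ satisfies $$\inf_{R\in\mathcal R^\Phi}\|R-R^*\|_{L^\infty(\mu_{ui})}\le 3pM\epsilon .$$ The constants $C,s,L,\tilde L$ depend neither on $\epsilon$ nor on $f^*,\tilde f^*$. -/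

import Mathlib

open MeasureTheory Filter Topology
open scoped NNReal ENNReal

noncomputable section

namespace TwoTower

/-- The unit cube `[0,1]^D`. The type `Fin D → ℝ` carries the sup norm. -/
def cube (D : ℕ) : Set (Fin D → ℝ) := Set.Icc 0 1

/-! ### Hölder balls -/

/-- The mixed partial derivative `∂_{v 0} ⋯ ∂_{v (k-1)} f` on the closed cube. Every `∂^α f` with
`|α|₁ = k` is of this form, `v` being a listing of the multi-index `α` (by symmetry of the
derivatives the order of the listing plays no role), and conversely. -/
def cubePartial {D k : ℕ} (v : Fin k → Fin D) (f : (Fin D → ℝ) → ℝ) (x : Fin D → ℝ) : ℝ :=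
  iteratedFDerivWithin ℝ k f (cube D) x (fun i => Pi.single (v i) 1)

/-- The Hölder norm of smoothness `β` on the cube, with values in `[0,∞]`:
`max_{|α|₁ < β} sup_x |∂^α f x|
  + max_{|α|₁ = ⌊β⌋} sup_{x ≠ x'} |∂^α f x - ∂^α f x'| / ‖x - x'‖_∞ ^ (β - ⌊β⌋)`. -/
def holderNorm (β : ℝ) {D : ℕ} (f : (Fin D → ℝ) → ℝ) : ℝ≥0∞ :=
  (⨆ (k : ℕ) (_ : (k : ℝ) < β) (v : Fin k → Fin D) (x : Fin D → ℝ) (_ : x ∈ cube D),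
      ENNReal.ofReal |cubePartial v f x|) +
  (⨆ (v : Fin ⌊β⌋₊ → Fin D) (x : Fin D → ℝ) (_ : x ∈ cube D) (x' : Fin D → ℝ) (_ : x' ∈ cube D)
      (_ : x ≠ x'),
      ENNReal.ofReal (|cubePartial v f x - cubePartial v f x'| / ‖x - x'‖ ^ (β - (⌊β⌋₊ : ℝ))))

/-- The closed Hölder ball of radius `M`: the functions that are `⌊β⌋` times continuously
differentiable on the cube with Hölder norm at most `M`. Only the values on the cube matter. -/
def holderBall (β : ℝ) (D : ℕ) (M : ℝ) : Set ((Fin D → ℝ) → ℝ) :=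
  {f | ContDiffOn ℝ (⌊β⌋₊ : ℕ) f (cube D) ∧ holderNorm β f ≤ ENNReal.ofReal M}

/-! ### Upper Minkowski dimension -/

/-- `N(r, S) * r ^ d`, with `N(r, S)` the least number of sup-norm balls of radius `r` that
cover `S`. -/
def coverMass {D : ℕ} (S : Set (Fin D → ℝ)) (d r : ℝ≥0) : ℝ≥0∞ :=
  ((Metric.externalCoveringNumber r S : ℕ∞) : ℝ≥0∞) * (r : ℝ≥0∞) ^ (d : ℝ)

/-- The upper Minkowski dimension `inf {d ≥ 0 | limsup_{r → 0} N(r, S) r ^ d = 0}`. -/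
def upperMinkowskiDim {D : ℕ} (S : Set (Fin D → ℝ)) : ℝ≥0∞ :=
  ⨅ (d : ℝ≥0) (_ : limsup (coverMass S d) (𝓝[>] (0 : ℝ≥0)) = 0), (d : ℝ≥0∞)

/-! ### ReLU networks -/

/-- Parameters `((A₁,b₁),…,(A_L,b_L))` of a ReLU network with input dimension `m` and output
dimension `n`, with arbitrary depth and widths. Hidden layers apply the ReLU; the last layer is
affine. -/
inductive Net : ℕ → ℕ → Type
  | last {m n : ℕ} (A : Matrix (Fin n) (Fin m) ℝ) (b : Fin n → ℝ) : Net m n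
  | layer {m k n : ℕ} (A : Matrix (Fin k) (Fin m) ℝ) (b : Fin k → ℝ) (rest : Net k n) : Net m n

namespace Net

/-- The function computed by the network. -/
def eval : {m n : ℕ} → Net m n → (Fin m → ℝ) → (Fin n → ℝ)
  | _, _, last A b, x => A.mulVec x + b
  | _, _, layer A b rest, x => rest.eval (fun i => max ((A.mulVec x + b) i) 0)

/-- The number of layers `U`. -/
def depth : {m n : ℕ} → Net m n → ℕ
  | _, _, last _ _ => 1
  | _, _, layer _ _ rest => rest.depth + 1

/-- The number of nonzero entries of one layer, `|b|₀ + |vec A|₀`. -/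
def layerSize {m n : ℕ} (A : Matrix (Fin n) (Fin m) ℝ) (b : Fin n → ℝ) : ℕ :=
  (Finset.univ.filter fun i => b i ≠ 0).card +
    (Finset.univ.filter fun q : Fin n × Fin m => A q.1 q.2 ≠ 0).card

/-- The number of effective (that is, nonzero) parameters `Z`. -/
def size : {m n : ℕ} → Net m n → ℕ
  | _, _, last A b => layerSize A b
  | _, _, layer A b rest => layerSize A b + rest.size

/-- The largest absolute value of a parameter of one layer, `max (‖b‖_∞, ‖vec A‖_∞)`. -/
def layerScale {m n : ℕ} (A : Matrix (Fin n) (Fin m) ℝ) (b : Fin n → ℝ) : ℝ≥0 :=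
  max (Finset.univ.sup fun i => ‖b i‖₊)
    (Finset.univ.sup fun q : Fin n × Fin m => ‖A q.1 q.2‖₊)

/-- The parameter scale `D`: the largest absolute value of a parameter. -/
def scale : {m n : ℕ} → Net m n → ℝ≥0
  | _, _, last A b => layerScale A b
  | _, _, layer A b rest => max (layerScale A b) rest.scale

end Net

/-- The class `F_D(W, L, B, M)` of functions `ℝ^D → ℝ^p` computed by a ReLU network with at most
`W` nonzero parameters, at most `L` layers and parameter scale at most `B`, with coordinates
bounded by `2M` on the cube. -/
def netClass (D p W L : ℕ) (B M : ℝ) : Set ((Fin D → ℝ) → (Fin p → ℝ)) :=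
  {f | ∃ Θ : Net D p, Θ.eval = f ∧ Θ.size ≤ W ∧ Θ.depth ≤ L ∧ (Θ.scale : ℝ) ≤ B ∧
    ∀ x ∈ cube D, ∀ j, |f x j| ≤ 2 * M}

/-! ### Two-tower models -/

/-- The two-tower function `(x, x') ↦ ⟨f x, f' x'⟩`. -/
def pairing {Du Di p : ℕ} (f : (Fin Du → ℝ) → (Fin p → ℝ)) (f' : (Fin Di → ℝ) → (Fin p → ℝ)) :
    (Fin Du → ℝ) × (Fin Di → ℝ) → ℝ :=
  fun z => ∑ j, f z.1 j * f' z.2 j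

/-- The class `R^Φ` of two-tower models, `Φ = (W, L, B, M, W', L', B')`. -/
def twoTowerClass (Du Di p W L : ℕ) (B M : ℝ) (W' L' : ℕ) (B' : ℝ) :
    Set ((Fin Du → ℝ) × (Fin Di → ℝ) → ℝ) :=
  {R | ∃ f ∈ netClass Du p W L B M, ∃ f' ∈ netClass Di p W' L' B' M, R = pairing f f'}

/-- The sup-norm of `g` on the support of `μ`, with values in `[0,∞]`. -/
def supNorm {X : Type*} [TopologicalSpace X] [MeasurableSpace X] (μ : Measure X) (g : X → ℝ) :
    ℝ≥0∞ :=
  ⨆ x ∈ μ.support, ENNReal.ofReal |g x|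

end TwoTower

end

/-!
The theorem reduces to a statement about one tower: on a set `S` in the cube that is covered by
`O(r ^ (-d))` balls of radius `r`, every function of a Hölder ball is approximated up to `ε` by a
ReLU network of bounded depth with `O(ε ^ (-d / β))` nonzero parameters (`exists_reluNet_holder`).
Truncating the coordinates at `± 2 M` and using
`|⟨f, f'⟩ - ⟨g, g'⟩| ≤ |⟨f, f' - g'⟩| + |⟨f - g, g'⟩|` gives the error `3 p M ε`. If `ε > M / 3`,
the zero network is good enough.

For one tower, cut the space into cells of side `r ≈ ε ^ (1 / β)`. Only `O(r ^ (-d))` of them meet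
`S`, and in each of these the Taylor polynomial of order `⌊β⌋` at a point of `S` is accurate
(`abs_sub_taylorSum_le`). Evaluating a polynomial separately for every cell would take too many
parameters, so the network works in two stages. The first stage has `O(1)` parameters per cell and
only looks up data: the cells are coloured with `8 ^ D` colours so that cells of the same colour are
far apart, and for each colour sums of bump functions return the centre near `x`, the Taylor
coefficients at this centre, and a weight `χ` that is `1` on the cells of this colour and vanishes
as soon as the lookup is no longer exact (`features`). The second stage is a single fixed
polynomial in these boundedly many features: the Taylor polynomials of the colours are blended by
`Q ↦ Q + χ (P - Q)` (`exists_blend`), which needs no partition of unity.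

It remains to approximate a fixed polynomial up to `δ` at bounded depth with `O(δ ^ (-η))`
parameters, where `η = d / β > 0` (`NetApprox`). This reduces to multiplication, hence to
`q t = t (1 - t)` on `[0, 1]`. If `T` is the sawtooth with `m` teeth and `I` interpolates `t ^ 2` at
the multiples of `1 / m`, then `q = (t - I) + m⁻² q ∘ T` (`ramps_spec`). Iterating this `k` times
leaves an error `m ^ (-2 k)` with `O(m)` parameters; take `m ≈ δ ^ (-η)` and the constant
`k ≥ 1 / (2 η)`. For `d = 0` the set `S` is finite, and a network of constant size interpolates.
-/

namespace TwoTower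

/-! ### A calculus of ReLU networks -/

/-- The affine map with matrix `A` and bias `b`, for arbitrary finite index types. -/
def affineMap {ι κ : Type} [Fintype ι] (A : κ → ι → ℝ) (b : κ → ℝ) (x : ι → ℝ) : κ → ℝ :=
  fun k => ∑ i, A k i * x i + b k

/-- `0` if `t = 0`, and `1` otherwise: the contribution of a parameter `t` to the size. -/
noncomputable def nz (t : ℝ) : ℝ := if t = 0 then 0 else 1

theorem nz_zero : nz 0 = 0 := by simp [nz]

theorem nz_nonneg (t : ℝ) : 0 ≤ nz t := by unfold nz; split_ifs <;> norm_num

theorem nz_le_one (t : ℝ) : nz t ≤ 1 := by unfold nz; split_ifs <;> norm_num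

theorem nz_neg (t : ℝ) : nz (-t) = nz t := by simp [nz]

/-- The number of nonzero parameters of an affine layer. -/
noncomputable def layerCost {ι κ : Type} [Fintype ι] [Fintype κ] (A : κ → ι → ℝ) (b : κ → ℝ) : ℝ :=
  ∑ k, (nz (b k) + ∑ i, nz (A k i))

theorem layerCost_nonneg {ι κ : Type} [Fintype ι] [Fintype κ] (A : κ → ι → ℝ) (b : κ → ℝ) :
    0 ≤ layerCost A b :=
  Finset.sum_nonneg fun _ _ => add_nonneg (nz_nonneg _) (Finset.sum_nonneg fun _ _ => nz_nonneg _)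

theorem layerCost_le {ι κ : Type} [Fintype ι] [Fintype κ] (A : κ → ι → ℝ) (b : κ → ℝ) :
    layerCost A b ≤ Fintype.card κ * (1 + Fintype.card ι) := by
  calc layerCost A b ≤ ∑ _k : κ, (1 + ∑ _i : ι, (1 : ℝ)) :=
        Finset.sum_le_sum fun k _ => add_le_add (nz_le_one _)
          (Finset.sum_le_sum fun i _ => nz_le_one _)
    _ = _ := by simp [mul_add]

/-- All parameters of an affine layer are at most `B` in absolute value. -/
def LayerBdd {ι κ : Type} (A : κ → ι → ℝ) (b : κ → ℝ) (B : ℝ) : Prop :=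
  (∀ k i, |A k i| ≤ B) ∧ ∀ k, |b k| ≤ B

/-- `ReluNet L W B F`: the map `F` is computed by a ReLU network with exactly `L` hidden layers, at
most `W` nonzero parameters and parameters of absolute value at most `B`. In contrast to `Net`, the
recursion peels off the output layer, neurons are indexed by arbitrary finite types, and the size
bound is real. -/
def ReluNet {ι : Type} [Fintype ι] : ℕ → ℝ → ℝ → ∀ {κ : Type} [Fintype κ],
    ((ι → ℝ) → (κ → ℝ)) → Prop
  | 0, W, B, _, _, F => ∃ A b, F = affineMap A b ∧ layerCost A b ≤ W ∧ LayerBdd A b B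
  | L + 1, W, B, _, _, F => ∃ (ν : Type) (_ : Fintype ν) (G : (ι → ℝ) → (ν → ℝ)) (W' : ℝ),
      ∃ A b, ReluNet L W' B G ∧ F = (fun x => affineMap A b fun i => max (G x i) 0) ∧
        W' + layerCost A b ≤ W ∧ LayerBdd A b B

/-- The scalar version of `ReluNet`. -/
def ReluNet₁ {ι : Type} [Fintype ι] (L : ℕ) (W B : ℝ) (f : (ι → ℝ) → ℝ) : Prop :=
  ReluNet L W B fun x (_ : Unit) => f x

theorem layerBdd_elim_neg {ι κ : Type} {A : κ → ι → ℝ} {b : κ → ℝ} {B : ℝ} (h : LayerBdd A b B) :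
    LayerBdd (Sum.elim A (-A)) (Sum.elim b (-b)) B := by
  constructor
  · rintro (k | k) i <;> simpa using h.1 k i
  · rintro (k | k) <;> simpa using h.2 k

theorem affineMap_elim_neg {ι κ : Type} [Fintype ι] (A : κ → ι → ℝ) (b : κ → ℝ) (x : ι → ℝ) :
    affineMap (Sum.elim A (-A)) (Sum.elim b (-b)) x =
      Sum.elim (affineMap A b x) (-affineMap A b x) := by
  funext k
  rcases k with k | k
  · simp [affineMap]
  · simp [affineMap, Finset.sum_neg_distrib]; ring

section calculus

variable {ι κ ν : Type} [Fintype ι] [Fintype κ] [Fintype ν]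

theorem ReluNet.mono {L : ℕ} {W B W' B' : ℝ} {F : (ι → ℝ) → (κ → ℝ)} (h : ReluNet L W B F)
    (hW : W ≤ W') (hB : B ≤ B') : ReluNet L W' B' F := by
  induction L generalizing W W' κ with
  | zero =>
    obtain ⟨A, b, hF, hc, hb⟩ := h
    exact ⟨A, b, hF, hc.trans hW, fun k i => (hb.1 k i).trans hB, fun k => (hb.2 k).trans hB⟩
  | succ L ih =>
    obtain ⟨ν, _, G, W₁, A, b, hG, hF, hc, hb⟩ := h
    exact ⟨ν, _, G, W₁, A, b, ih hG le_rfl, hF, hc.trans hW, fun k i => (hb.1 k i).trans hB,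
      fun k => (hb.2 k).trans hB⟩

theorem ReluNet₁.mono {L : ℕ} {W B W' B' : ℝ} {f : (ι → ℝ) → ℝ} (h : ReluNet₁ L W B f)
    (hW : W ≤ W') (hB : B ≤ B') : ReluNet₁ L W' B' f :=
  ReluNet.mono h hW hB

theorem ReluNet.size_nonneg {L : ℕ} {W B : ℝ} {F : (ι → ℝ) → (κ → ℝ)} (h : ReluNet L W B F) :
    0 ≤ W := by
  induction L generalizing W κ with
  | zero =>
    obtain ⟨A, b, -, hc, -⟩ := h
    exact (layerCost_nonneg A b).trans hc
  | succ L ih =>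
    obtain ⟨ν, _, G, W₁, A, b, hG, -, hc, -⟩ := h
    have := ih hG
    have := layerCost_nonneg A b
    linarith

theorem layerCost_elim_neg (A : κ → ι → ℝ) (b : κ → ℝ) :
    layerCost (Sum.elim A (-A)) (Sum.elim b (-b)) = 2 * layerCost A b := by
  simp [layerCost, nz_neg, Fintype.sum_sum_type]
  ring

/-- Outputs `F` and `-F` together, at twice the size. -/
theorem ReluNet.elim_neg {L : ℕ} {W B : ℝ} {F : (ι → ℝ) → (κ → ℝ)} (h : ReluNet L W B F) :
    ReluNet L (2 * W) B fun x => Sum.elim (F x) (-F x) := by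
  cases L with
  | zero =>
    obtain ⟨A, b, rfl, hc, hb⟩ := h
    refine ⟨_, _, funext fun x => (affineMap_elim_neg A b x).symm, ?_, layerBdd_elim_neg hb⟩
    rw [layerCost_elim_neg]; linarith
  | succ L =>
    obtain ⟨ν, _, G, W₁, A, b, hG, rfl, hc, hb⟩ := h
    refine ⟨ν, _, G, W₁, _, _, hG, funext fun x => (affineMap_elim_neg A b _).symm, ?_,
      layerBdd_elim_neg hb⟩
    rw [layerCost_elim_neg]
    have := hG.size_nonneg
    linarith

/-- Composition of networks. The output layer of `F` and the first layer of `G` are not multiplied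
together, which would spoil the bounds on size and parameters; they are joined through
`y = max y 0 - max (-y) 0`. -/
theorem ReluNet.comp {L₁ L₂ : ℕ} {W₁ W₂ B : ℝ} {F : (ι → ℝ) → (κ → ℝ)} {G : (κ → ℝ) → (ν → ℝ)}
    (hG : ReluNet L₂ W₂ B G) (hF : ReluNet L₁ W₁ B F) :
    ReluNet (L₁ + L₂ + 1) (2 * W₁ + 2 * W₂) B fun x => G (F x) := by
  induction L₂ generalizing W₂ ν with
  | zero =>
    obtain ⟨A, b, rfl, hc, hb⟩ := hG
    refine ⟨κ ⊕ κ, inferInstance, fun x => Sum.elim (F x) (-F x), 2 * W₁,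
      fun k => Sum.elim (A k) (-A k), b, hF.elim_neg, ?_, ?_, ?_, hb.2⟩
    · funext x k
      simp only [affineMap, Fintype.sum_sum_type, Sum.elim_inl, Sum.elim_inr, Pi.neg_apply,
        ← Finset.sum_add_distrib]
      congr 1
      refine Finset.sum_congr rfl fun i _ => ?_
      have := max_zero_sub_eq_self (F x i)
      rw [max_comm, max_comm (-F x i)] at this
      rw [max_comm, max_comm (-F x i)]
      linear_combination (-A k i) * this
    · have h0 : layerCost (fun k => Sum.elim (A k) (-A k)) b ≤ 2 * layerCost A b := by
        unfold layerCost
        rw [Finset.mul_sum]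
        refine Finset.sum_le_sum fun k _ => ?_
        have := nz_nonneg (b k)
        simp only [Fintype.sum_sum_type, Sum.elim_inl, Sum.elim_inr, Pi.neg_apply, nz_neg]
        linarith
      linarith
    · rintro k (i | i) <;> simpa using hb.1 k i
  | succ L₂ ih =>
    obtain ⟨μ, _, G', W', A, b, hG', rfl, hc, hb⟩ := hG
    refine ⟨μ, _, fun x => G' (F x), _, A, b, ih hG', rfl, ?_, hb⟩
    have := layerCost_nonneg A b
    linarith

end calculus

section parallel

variable {ι : Type} [Fintype ι]

/-- Networks with the same number of hidden layers can be run in parallel. -/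
theorem ReluNet.sigma {I : Type} [Fintype I] {κ : I → Type} [∀ i, Fintype (κ i)] {L : ℕ}
    {W : I → ℝ} {B : ℝ} {F : ∀ i, (ι → ℝ) → (κ i → ℝ)} (hB : 0 ≤ B)
    (h : ∀ i, ReluNet L (W i) B (F i)) :
    ReluNet L (∑ i, W i) B fun x (k : Σ i, κ i) => F k.1 x k.2 := by
  classical
  induction L generalizing W κ with
  | zero =>
    choose A b hF hc hb using h
    refine ⟨fun k => A k.1 k.2, fun k => b k.1 k.2, ?_, ?_, fun k i => (hb k.1).1 k.2 i,
      fun k => (hb k.1).2 k.2⟩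
    · funext x k; rw [hF k.1]; rfl
    · unfold layerCost
      rw [Fintype.sum_sigma]
      exact Finset.sum_le_sum fun i _ => hc i
  | succ L ih =>
    choose ν hν G W' A b hG hF hc hb using h
    have key := ih hG
    refine ⟨Σ i, ν i, inferInstance, _, _,
      fun k j => if h : k.1 = j.1 then A k.1 k.2 (h ▸ j.2) else 0,
      fun k => b k.1 k.2, key, ?_, ?_, ?_, fun k => (hb k.1).2 k.2⟩
    · funext x k
      rcases k with ⟨i, k⟩
      simp only [hF i, affineMap, Fintype.sum_sigma]
      congr 1
      rw [Finset.sum_eq_single i]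
      · simp
      · intro j _ hj
        simp [Ne.symm hj]
      · simp
    · have h0 : layerCost (κ := Σ i, κ i) (ι := Σ i, ν i)
          (fun k j => if h : k.1 = j.1 then A k.1 k.2 (h ▸ j.2) else 0)
          (fun k => b k.1 k.2) = ∑ i, layerCost (A i) (b i) := by
        unfold layerCost
        rw [Fintype.sum_sigma]
        refine Finset.sum_congr rfl fun i _ => Finset.sum_congr rfl fun k _ => ?_
        congr 1
        rw [Fintype.sum_sigma, Finset.sum_eq_single i]
        · simp
        · intro j _ hj
          simp [Ne.symm hj, nz_zero]
        · simp
      rw [h0, ← Finset.sum_add_distrib]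
      exact Finset.sum_le_sum fun i _ => hc i
    · intro k j
      dsimp only
      split_ifs with h
      · exact (hb k.1).1 k.2 _
      · simpa using hB

theorem layerCost_comp_equiv {κ κ' : Type} [Fintype κ] [Fintype κ'] (A : κ → ι → ℝ) (b : κ → ℝ)
    (e : κ' ≃ κ) : layerCost (fun k => A (e k)) (fun k => b (e k)) = layerCost A b := by
  unfold layerCost
  exact e.sum_comp fun k => nz (b k) + ∑ i, nz (A k i)

theorem ReluNet.comp_equiv {κ κ' : Type} [Fintype κ] [Fintype κ'] {L : ℕ} {W B : ℝ}
    {F : (ι → ℝ) → (κ → ℝ)} (h : ReluNet L W B F) (e : κ' ≃ κ) :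
    ReluNet L W B fun x k => F x (e k) := by
  cases L with
  | zero =>
    obtain ⟨A, b, rfl, hc, hb⟩ := h
    exact ⟨_, _, rfl, (layerCost_comp_equiv A b e).trans_le hc, fun k i => hb.1 _ i,
      fun k => hb.2 _⟩
  | succ L =>
    obtain ⟨ν, _, G, W₁, A, b, hG, rfl, hc, hb⟩ := h
    refine ⟨ν, _, G, W₁, _, _, hG, rfl, ?_, fun k i => hb.1 (e k) i, fun k => hb.2 (e k)⟩
    rwa [layerCost_comp_equiv A b e]

/-- Scalar networks with the same number of hidden layers, run in parallel. -/
theorem ReluNet.pi {I : Type} [Fintype I] {L : ℕ} {W : I → ℝ} {B : ℝ} {f : I → (ι → ℝ) → ℝ}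
    (hB : 0 ≤ B) (h : ∀ i, ReluNet₁ L (W i) B (f i)) :
    ReluNet L (∑ i, W i) B fun x i => f i x :=
  (ReluNet.sigma hB h).comp_equiv (Equiv.sigmaPUnit I).symm

theorem ReluNet₁.of_affine {B : ℝ} {a : ι → ℝ} {c : ℝ} (ha : ∀ i, |a i| ≤ B) (hc : |c| ≤ B) :
    ReluNet₁ 0 (1 + Fintype.card ι) B fun x => ∑ i, a i * x i + c :=
  ⟨fun _ i => a i, fun _ => c, rfl,
    by simpa using layerCost_le (fun (_ : Unit) i => a i) fun _ => c, fun _ i => ha i, fun _ => hc⟩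

theorem ReluNet₁.affine {L : ℕ} {W B : ℝ} {I : Type} [Fintype I] {f : I → (ι → ℝ) → ℝ}
    (hB : 0 ≤ B) (h : ∀ i, ReluNet₁ L W B (f i)) {a : I → ℝ} {c : ℝ} (ha : ∀ i, |a i| ≤ B)
    (hc : |c| ≤ B) :
    ReluNet₁ (L + 1) (2 * (Fintype.card I * W) + 2 * (1 + Fintype.card I)) B
      fun x => ∑ i, a i * f i x + c := by
  refine ReluNet.mono (ReluNet.comp (ReluNet₁.of_affine ha hc) (ReluNet.pi hB h)) ?_ le_rfl
  simp

/-- An affine functional of rectified scalar networks; this adds one hidden layer. -/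
theorem ReluNet₁.relu {L : ℕ} {B : ℝ} {I : Type} [Fintype I] {W : I → ℝ} {f : I → (ι → ℝ) → ℝ}
    (hB : 0 ≤ B) (h : ∀ i, ReluNet₁ L (W i) B (f i)) {a : I → ℝ} {c : ℝ} (ha : ∀ i, |a i| ≤ B)
    (hc : |c| ≤ B) :
    ReluNet₁ (L + 1) (∑ i, W i + (1 + Fintype.card I)) B
      fun x => ∑ i, a i * max (f i x) 0 + c :=
  ⟨I, _, _, _, fun _ i => a i, fun _ => c, ReluNet.pi hB h, rfl, by
    simpa using layerCost_le (fun (_ : Unit) i => a i) fun _ => c, fun _ i => ha i, fun _ => hc⟩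

/-- An affine functional in one coordinate. -/
theorem ReluNet₁.coord {B : ℝ} (i : ι) {a c : ℝ} (ha : |a| ≤ B) (hc : |c| ≤ B) :
    ReluNet₁ 0 2 B fun x : ι → ℝ => a * x i + c := by
  classical
  refine ⟨fun _ j => if j = i then a else 0, fun _ => c, ?_, ?_, ?_, fun _ => hc⟩
  · funext x k
    simp [affineMap]
  · have : ∀ j, nz (if j = i then a else 0) = if j = i then nz a else 0 := by
      intro j; split_ifs <;> simp [nz_zero]
    simp only [layerCost, this]
    simp
    have := nz_le_one a
    have := nz_le_one c
    linarith
  · intro k j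
    dsimp only
    split_ifs
    · exact ha
    · simpa using (abs_nonneg a).trans ha

/-- Extra hidden layers, by composition with the identity. -/
theorem ReluNet₁.pad {L : ℕ} {W B : ℝ} {f : (ι → ℝ) → ℝ} (h : ReluNet₁ L W B f) (hB : 1 ≤ B)
    (n : ℕ) : ReluNet₁ (L + n) (4 ^ n * (W + 2)) B f := by
  induction n with
  | zero => exact ReluNet.mono h (by linarith) le_rfl
  | succ n ih =>
    have hid : ReluNet (ι := Unit) (κ := Unit) 0 2 B fun x k => 1 * x () + 0 :=
      ReluNet₁.coord () (by simpa using hB) (by simp; linarith)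
    have h2 := hid.comp ih
    have h3 : ReluNet₁ (L + n + 0 + 1) (2 * (4 ^ n * (W + 2)) + 2 * 2) B f := by
      unfold ReluNet₁
      simpa using h2
    refine ReluNet.mono h3 ?_ le_rfl
    have h0 : 0 ≤ W := h.size_nonneg
    have : (1:ℝ) ≤ 4 ^ n := one_le_pow₀ (by norm_num)
    rw [pow_succ]
    nlinarith

end parallel

/-! ### Realization by networks of type `Net` -/

theorem layerSize_of {m n : ℕ} (A : Fin n → Fin m → ℝ) (b : Fin n → ℝ) :
    (Net.layerSize (Matrix.of A) b : ℝ) = layerCost A b := by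
  have h : ∀ {α : Type} [Fintype α] (v : α → ℝ),
      (((Finset.univ.filter fun a => v a ≠ 0).card : ℕ) : ℝ) = ∑ a, nz (v a) := by
    intro α _ v
    simp [nz, Finset.card_filter, ite_not]
  unfold Net.layerSize layerCost
  push_cast
  rw [h b, h fun q : Fin n × Fin m => Matrix.of A q.1 q.2, Finset.sum_add_distrib,
    Fintype.sum_prod_type]
  rfl

theorem layerScale_of_le {m n : ℕ} {A : Fin n → Fin m → ℝ} {b : Fin n → ℝ} {B : ℝ}
    (hB : 0 ≤ B) (h : LayerBdd A b B) : (Net.layerScale (Matrix.of A) b : ℝ) ≤ B := by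
  lift B to ℝ≥0 using hB
  rw [NNReal.coe_le_coe]
  refine max_le (Finset.sup_le fun i _ => ?_) (Finset.sup_le fun q _ => ?_)
  · exact h.2 i
  · exact h.1 q.1 q.2

/-- A rectification and an affine output layer can be appended to a network. -/
theorem Net.exists_append {m n : ℕ} (Θ : Net m n) {k : ℕ} (A : Matrix (Fin k) (Fin n) ℝ)
    (b : Fin k → ℝ) :
    ∃ Θ' : Net m k, (∀ x, Θ'.eval x = A.mulVec (fun i => max (Θ.eval x i) 0) + b) ∧
      Θ'.size = Θ.size + Net.layerSize A b ∧ Θ'.depth = Θ.depth + 1 ∧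
      Θ'.scale = max Θ.scale (Net.layerScale A b) := by
  induction Θ with
  | last A₀ b₀ => exact ⟨.layer A₀ b₀ (.last A b), fun x => rfl, rfl, rfl, rfl⟩
  | layer A₀ b₀ rest ih =>
    obtain ⟨Θ', h1, h2, h3, h4⟩ := ih A
    refine ⟨.layer A₀ b₀ Θ', fun x => h1 _, ?_, ?_, ?_⟩
    · simp only [Net.size, h2]; ring
    · simp only [Net.depth, h3]
    · simp only [Net.scale, h4, max_assoc]

theorem ReluNet.exists_net {m n : ℕ} {κ : Type} [Fintype κ] {L : ℕ} {W B : ℝ}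
    {F : (Fin m → ℝ) → (κ → ℝ)} (h : ReluNet L W B F) (hB : 0 ≤ B) (e : Fin n ≃ κ) :
    ∃ Θ : Net m n, (∀ x i, Θ.eval x i = F x (e i)) ∧ (Θ.size : ℝ) ≤ W ∧ Θ.depth = L + 1 ∧
      (Θ.scale : ℝ) ≤ B := by
  induction L generalizing W κ n with
  | zero =>
    obtain ⟨A, b, rfl, hc, hb⟩ := h
    refine ⟨.last (Matrix.of fun k i => A (e k) i) (fun k => b (e k)), fun x i => rfl, ?_, rfl, ?_⟩
    · rw [Net.size, layerSize_of]
      exact (layerCost_comp_equiv A b e).trans_le hc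
    · exact layerScale_of_le hB ⟨fun k i => hb.1 _ _, fun k => hb.2 _⟩
  | succ L ih =>
    obtain ⟨ν, _, G, W₁, A, b, hG, rfl, hc, hb⟩ := h
    obtain ⟨Θ, h1, h2, h3, h4⟩ := ih hG (Fintype.equivFin ν).symm
    set e' := (Fintype.equivFin ν).symm
    obtain ⟨Θ', k1, k2, k3, k4⟩ := Θ.exists_append (Matrix.of fun k i => A (e k) (e' i))
      (fun k => b (e k))
    refine ⟨Θ', fun x i => ?_, ?_, by rw [k3, h3], ?_⟩
    · simp only [k1, h1]
      refine congrArg (· + b (e i)) ?_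
      exact e'.sum_comp fun j => A (e i) j * max (G x j) 0
    · rw [k2]
      push_cast
      rw [layerSize_of]
      have : layerCost (fun k i => A (e k) (e' i)) (fun k => b (e k)) = layerCost A b := by
        rw [← layerCost_comp_equiv A b e]
        unfold layerCost
        refine Finset.sum_congr rfl fun k _ => ?_
        congr 1
        exact e'.sum_comp fun j => nz (A (e k) j)
      linarith
    · rw [k4, NNReal.coe_max]
      exact max_le h4 (layerScale_of_le hB ⟨fun k i => hb.1 _ _, fun k => hb.2 _⟩)

/-! ### Approximate multiplication at bounded depth -/

/-- The coefficients of the piecewise linear interpolant of `t ^ 2` at the points `i / m`. -/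
noncomputable def interpCoeff (m i : ℕ) : ℝ := if i = 0 then 1 / m else 2 / m

/-- The coefficients of the sawtooth with slopes `± m` on the intervals `[i / m, (i + 1) / m]`. -/
noncomputable def sawCoeff (m i : ℕ) : ℝ := if i = 0 then m else 2 * m * (-1) ^ i

/-- The function with slope jumps `c i` at the points `i / m`. -/
noncomputable def ramps (m : ℕ) (c : ℕ → ℝ) (t : ℝ) : ℝ :=
  ∑ i : Fin m, c i * max (t - i / m) 0

theorem ramps_eq {m j : ℕ} (c : ℕ → ℝ) {t : ℝ} (hj : j < m) (h1 : (j : ℝ) ≤ m * t)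
    (h2 : m * t ≤ j + 1) : ramps m c t = ∑ i ∈ Finset.range (j + 1), c i * (t - i / m) := by
  have hm : (0 : ℝ) < m := by exact_mod_cast (Nat.zero_le j).trans_lt hj
  unfold ramps
  rw [Fin.sum_univ_eq_sum_range (fun i => c i * max (t - i / m) 0) m,
    ← Finset.sum_subset (Finset.range_subset_range.2 (Nat.succ_le_of_lt hj))]
  · refine Finset.sum_congr rfl fun i hi => ?_
    have : (i : ℝ) ≤ j := by exact_mod_cast Nat.lt_succ_iff.1 (Finset.mem_range.1 hi)
    rw [max_eq_left]
    rw [sub_nonneg, div_le_iff₀ hm]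
    linarith
  · intro i _ hi
    have : (j : ℝ) + 1 ≤ i := by
      have := not_lt.1 (fun h => hi (Finset.mem_range.2 h))
      exact_mod_cast this
    rw [max_eq_right, mul_zero]
    rw [sub_nonpos, le_div_iff₀ hm]
    linarith

theorem sum_interpCoeff {m : ℕ} (hm : m ≠ 0) (t : ℝ) (j : ℕ) :
    ∑ i ∈ Finset.range (j + 1), interpCoeff m i * (t - i / m) =
      ((2 * j + 1) * t - j * (j + 1) / m) / m := by
  have : (m : ℝ) ≠ 0 := by exact_mod_cast hm
  induction j with
  | zero => simp [interpCoeff]; ring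
  | succ j ih =>
    rw [Finset.sum_range_succ, ih]
    simp only [interpCoeff, Nat.succ_ne_zero, if_false]
    push_cast
    field_simp
    ring

theorem sum_sawCoeff {m : ℕ} (hm : m ≠ 0) (t : ℝ) (j : ℕ) :
    ∑ i ∈ Finset.range (j + 1), sawCoeff m i * (t - i / m) =
      (-1) ^ j * (m * t - j - 1 / 2) + 1 / 2 := by
  have : (m : ℝ) ≠ 0 := by exact_mod_cast hm
  induction j with
  | zero => simp [sawCoeff]
  | succ j ih =>
    rw [Finset.sum_range_succ, ih]
    simp only [sawCoeff, Nat.succ_ne_zero, if_false]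
    push_cast
    field_simp
    ring

/-- On `[0, 1]` the sawtooth `T` has values in `[0, 1]`, and the error of the interpolant of `t ^ 2`
is the rescaled copy `m⁻² T (1 - T)` of the function `t (1 - t)`. -/
theorem ramps_spec {m : ℕ} (hm : m ≠ 0) {t : ℝ} (h0 : 0 ≤ t) (h1 : t ≤ 1) :
    (0 ≤ ramps m (sawCoeff m) t ∧ ramps m (sawCoeff m) t ≤ 1) ∧
      t * (1 - t) = t - ramps m (interpCoeff m) t +
        ((m : ℝ) ^ 2)⁻¹ * (ramps m (sawCoeff m) t * (1 - ramps m (sawCoeff m) t)) := by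
  have hm' : (0 : ℝ) < m := by exact_mod_cast Nat.pos_of_ne_zero hm
  obtain ⟨j, hj, hj1, hj2⟩ : ∃ j < m, (j : ℝ) ≤ m * t ∧ m * t ≤ j + 1 := by
    rcases h1.lt_or_eq with h | rfl
    · refine ⟨⌊m * t⌋₊, ?_, Nat.floor_le (by positivity), (Nat.lt_floor_add_one _).le⟩
      rw [Nat.floor_lt (by positivity)]
      nlinarith
    · refine ⟨m - 1, by omega, ?_, ?_⟩ <;> rw [Nat.cast_sub (by omega)] <;> push_cast <;> linarith
  rw [ramps_eq _ hj hj1 hj2, ramps_eq _ hj hj1 hj2, sum_interpCoeff hm, sum_sawCoeff hm]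
  have hs : ((-1 : ℝ) ^ j) ^ 2 = 1 := by rw [← pow_mul, mul_comm, pow_mul]; simp
  constructor
  · rcases neg_one_pow_eq_or ℝ j with h | h <;> rw [h] <;> constructor <;> linarith
  · have : ((-1) ^ j * (m * t - j - 1 / 2) + 1 / 2) *
        (1 - ((-1) ^ j * (m * t - j - 1 / 2) + 1 / 2)) = 1 / 4 - (m * t - j - 1 / 2) ^ 2 := by
      linear_combination (-(m * t - j - 1 / 2) ^ 2) * hs
    rw [this]
    field_simp
    ring

theorem reluNet_ramps {m : ℕ} (hm : m ≠ 0) {c : ℕ → ℝ} (hc : ∀ i, |c i| ≤ 2 * m) :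
    ReluNet₁ (ι := Unit) 1 (4 * m) (2 * m) fun x => ramps m c (x ()) := by
  have hm' : (1 : ℝ) ≤ m := by exact_mod_cast Nat.one_le_iff_ne_zero.2 hm
  have h := ReluNet₁.relu (ι := Unit) (I := Fin m) (L := 0) (B := 2 * m) (W := fun _ => 2)
    (f := fun i x => 1 * x () + (-(i / m))) (by positivity)
    (fun i => ReluNet₁.coord () (by rw [abs_one]; linarith) (by
      rw [abs_neg, abs_of_nonneg (by positivity), div_le_iff₀ (by positivity)]
      have : (i : ℝ) ≤ m := by exact_mod_cast i.2.le
      nlinarith)) (a := fun i => c i) (c := 0) (fun i => hc i) (by simp)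
  have h' : ReluNet₁ (ι := Unit) 1 (m * 2 + (1 + m)) (2 * m) fun x => ramps m c (x ()) := by
    simpa [ramps, sub_eq_add_neg] using h
  exact ReluNet.mono h' (by linarith) le_rfl

theorem abs_interpCoeff_le {m : ℕ} (hm : m ≠ 0) (i : ℕ) : |interpCoeff m i| ≤ 2 * m := by
  have hm' : (1 : ℝ) ≤ m := by exact_mod_cast Nat.one_le_iff_ne_zero.2 hm
  unfold interpCoeff
  split_ifs <;> rw [abs_of_nonneg (by positivity), div_le_iff₀ (by positivity)] <;> nlinarith

theorem abs_sawCoeff_le (m i : ℕ) : |sawCoeff m i| ≤ 2 * m := by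
  have hm' : (0 : ℝ) ≤ m := by positivity
  unfold sawCoeff
  split_ifs
  · rw [abs_of_nonneg hm']; linarith
  · simp [abs_mul]

/-- The function `t (1 - t)` on `[0, 1]` up to an error `m ^ (-2 k)`, at a depth that depends only
on `k` and with `O(m)` parameters. -/
theorem exists_reluNet_parabola (k : ℕ) : ∃ (L : ℕ) (C : ℝ), 0 ≤ C ∧ ∀ m : ℕ, m ≠ 0 →
    ∃ f : (Unit → ℝ) → ℝ, ReluNet₁ L (C * m) (2 * m) f ∧
      ∀ t : ℝ, 0 ≤ t → t ≤ 1 → |f (fun _ => t) - t * (1 - t)| ≤ (((m : ℝ) ^ 2)⁻¹) ^ k := by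
  induction k with
  | zero =>
    refine ⟨0, 2, by norm_num, fun m hm => ⟨fun x => 0 * x () + 0, ?_, ?_⟩⟩
    · have hm' : (1 : ℝ) ≤ m := by exact_mod_cast Nat.one_le_iff_ne_zero.2 hm
      exact ReluNet.mono (ReluNet₁.coord (B := 2 * m) () (by simp) (by simp)) (by linarith) le_rfl
    · intro t h0 h1
      rw [abs_le, pow_zero]
      constructor <;> nlinarith
  | succ k ih =>
    obtain ⟨L, C, hC, ih⟩ := ih
    set V : ℝ := 4 ^ (L + 2) * (10 + 2 * C) with hV
    have h4 : (1 : ℝ) ≤ 4 ^ (L + 1) := one_le_pow₀ (by norm_num)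
    have h4' : (4 : ℝ) ^ (L + 2) = 4 * 4 ^ (L + 1) := by rw [pow_succ]; ring
    refine ⟨L + 3, 6 * V + 8, by positivity, fun m hm => ?_⟩
    obtain ⟨f, hf, hf'⟩ := ih m hm
    have hm' : (1 : ℝ) ≤ m := by exact_mod_cast Nat.one_le_iff_ne_zero.2 hm
    have hB : (1 : ℝ) ≤ 2 * m := by linarith
    have n1 : ReluNet₁ (ι := Unit) (L + 2) (V * m) (2 * m) fun x => x () := by
      have h0 : ReluNet₁ (ι := Unit) 0 2 (2 * m) fun x => x () := by
        simpa using
          ReluNet₁.coord (ι := Unit) (B := 2 * m) (a := 1) (c := 0) () (by simpa) (by simp)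
      have h := h0.pad hB (L + 2)
      rw [zero_add] at h
      refine ReluNet.mono h ?_ le_rfl
      rw [hV, mul_assoc]
      gcongr
      nlinarith
    have n2 : ReluNet₁ (ι := Unit) (L + 2) (V * m) (2 * m)
        fun x => ramps m (interpCoeff m) (x ()) := by
      have h := (reluNet_ramps hm (abs_interpCoeff_le hm)).pad hB (L + 1)
      rw [show 1 + (L + 1) = L + 2 by ring] at h
      refine ReluNet.mono h ?_ le_rfl
      rw [hV, h4']
      nlinarith [mul_nonneg (sub_nonneg.2 h4) hC, mul_nonneg (mul_nonneg (sub_nonneg.2 h4) hC)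
        (sub_nonneg.2 hm'), mul_nonneg hC (sub_nonneg.2 hm'),
        mul_nonneg (sub_nonneg.2 h4) (sub_nonneg.2 hm')]
    have n3 : ReluNet₁ (ι := Unit) (L + 2) (V * m) (2 * m)
        fun x => f fun _ => ramps m (sawCoeff m) (x ()) := by
      have h := ReluNet.comp hf (reluNet_ramps hm (abs_sawCoeff_le m))
      rw [show 1 + L + 1 = L + 2 by ring] at h
      refine ReluNet.mono h ?_ le_rfl
      rw [hV, h4']
      nlinarith [mul_nonneg (sub_nonneg.2 h4) hC, mul_nonneg (mul_nonneg (sub_nonneg.2 h4) hC)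
        (sub_nonneg.2 hm'), mul_nonneg hC (sub_nonneg.2 hm'),
        mul_nonneg (sub_nonneg.2 h4) (sub_nonneg.2 hm')]
    have hinv : ((m : ℝ) ^ 2)⁻¹ ≤ 1 := inv_le_one_of_one_le₀ (one_le_pow₀ hm')
    have hinv0 : 0 ≤ ((m : ℝ) ^ 2)⁻¹ := by positivity
    have n := ReluNet₁.affine (I := Fin 3) (B := 2 * m)
      (f := ![fun x => x (), fun x => ramps m (interpCoeff m) (x ()),
        fun x => f fun _ => ramps m (sawCoeff m) (x ())])
      (by positivity) (by
        intro i
        fin_cases i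
        exacts [n1, n2, n3]) (a := ![1, -1, ((m : ℝ) ^ 2)⁻¹]) (c := 0) (by
        intro i
        fin_cases i
        · simpa using hB
        · simpa using hB
        · simp only [Fin.reduceFinMk, Matrix.cons_val]
          rw [abs_of_nonneg hinv0]
          linarith) (by simp)
    refine ⟨_, ReluNet.mono n ?_ le_rfl, ?_⟩
    · simp only [Fintype.card_fin]
      push_cast
      nlinarith
    · intro t h0 h1
      obtain ⟨⟨hT0, hT1⟩, ht⟩ := ramps_spec hm h0 h1
      have := hf' _ hT0 hT1
      simp only [Fin.sum_univ_three, Matrix.cons_val_zero, Matrix.cons_val_one, Matrix.cons_val]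
      rw [ht, pow_succ (((m : ℝ) ^ 2)⁻¹) k]
      set T := ramps m (sawCoeff m) t
      have e : 1 * t + -1 * ramps m (interpCoeff m) t + ((m : ℝ) ^ 2)⁻¹ * f (fun _ => T) + 0 -
          (t - ramps m (interpCoeff m) t + ((m : ℝ) ^ 2)⁻¹ * (T * (1 - T))) =
          (f (fun _ => T) - T * (1 - T)) * ((m : ℝ) ^ 2)⁻¹ := by ring
      rw [e, abs_mul, abs_of_nonneg hinv0]
      exact mul_le_mul_of_nonneg_right this hinv0

/-- Multiplication on `[-K, K]²` by polarization, from the parabola. -/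
theorem exists_reluNet_mul_pow (k : ℕ) {K : ℝ} (hK : 1 ≤ K) : ∃ (L : ℕ) (C : ℝ), 0 ≤ C ∧
    ∀ m : ℕ, m ≠ 0 → ∃ f : (Fin 2 → ℝ) → ℝ, ReluNet₁ L (C * m) (C * m) f ∧
      ∀ z : Fin 2 → ℝ, (∀ i, |z i| ≤ K) →
        |f z - z 0 * z 1| ≤ 8 * K ^ 2 * (((m : ℝ) ^ 2)⁻¹) ^ k := by
  obtain ⟨L, C, hC, h⟩ := exists_reluNet_parabola k
  refine ⟨L + 2, 2 * (2 * (2 * 3 + 2 * C)) + 2 * 3 + 2 + 4 * K ^ 2, by positivity, fun m hm => ?_⟩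
  obtain ⟨f, hf, hf'⟩ := h m hm
  have hm' : (1 : ℝ) ≤ m := by exact_mod_cast Nat.one_le_iff_ne_zero.2 hm
  set B : ℝ := (2 + 4 * K ^ 2) * m with hB
  have hK2 : 1 ≤ K ^ 2 := one_le_pow₀ hK
  have hB1 : 1 ≤ B := by nlinarith
  have hBK : 4 * K ^ 2 ≤ B := by nlinarith
  have hBm : 2 * m ≤ B := by nlinarith
  have hinv0 : 0 ≤ (4 * K)⁻¹ := by positivity
  have hinv1 : (4 * K)⁻¹ ≤ 1 := inv_le_one_of_one_le₀ (by linarith)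
  have aff : ∀ s : ℝ, |s| = 1 → ReluNet₁ (ι := Fin 2) (L + 1) (2 * 3 + 2 * (C * m)) B
      fun z => f fun _ => 1 / 2 + (z 0 + s * z 1) / (4 * K) := by
    intro s hs
    have h1 := ReluNet₁.of_affine (ι := Fin 2) (B := B) (a := ![(4 * K)⁻¹, s * (4 * K)⁻¹])
      (c := 1 / 2) (by
        intro i
        fin_cases i
        · simp only [Fin.zero_eta, Matrix.cons_val_zero, abs_of_nonneg hinv0]; linarith
        · simp only [Fin.mk_one, Matrix.cons_val_one]
          simp only [Matrix.cons_val_fin_one, abs_mul, hs, abs_of_nonneg hinv0]; linarith)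
      (by rw [abs_of_nonneg (by norm_num)]; linarith)
    have h2 := ReluNet.comp (ReluNet.mono hf le_rfl hBm) h1
    have h3 : (fun z : Fin 2 → ℝ => f fun _ => 1 / 2 + (z 0 + s * z 1) / (4 * K)) =
        fun z => f fun _ => ∑ i, ![(4 * K)⁻¹, s * (4 * K)⁻¹] i * z i + 1 / 2 := by
      funext z
      congr 1
      funext _
      simp [Fin.sum_univ_two]
      ring
    rw [h3]
    rw [zero_add] at h2
    refine ReluNet.mono h2 ?_ le_rfl
    simp only [Fintype.card_fin]
    push_cast
    linarith
  have n := ReluNet₁.affine (I := Fin 2) (B := B)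
    (f := fun i z => f fun _ => 1 / 2 + (z 0 + (![-1, 1] : Fin 2 → ℝ) i * z 1) / (4 * K))
    (by linarith) (fun i => aff _ (by fin_cases i <;> simp))
    (a := ![4 * K ^ 2, -(4 * K ^ 2)]) (c := 0) (by
      intro i
      fin_cases i
      · simp; linarith
      · simp; linarith) (by simp; linarith)
  refine ⟨_, ReluNet.mono n ?_ ?_, ?_⟩
  · simp only [Fintype.card_fin]
    push_cast
    nlinarith
  · rw [hB]
    gcongr
    nlinarith
  · intro z hz
    have hx := abs_le.1 (hz 0)
    have hy := abs_le.1 (hz 1)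
    have hK0 : 0 < 4 * K := by linarith
    have key : ∀ w : ℝ, |w| ≤ 2 * K → |f (fun _ => 1 / 2 + w / (4 * K)) -
        (1 / 2 + w / (4 * K)) * (1 - (1 / 2 + w / (4 * K)))| ≤ (((m : ℝ) ^ 2)⁻¹) ^ k := by
      intro w hw
      obtain ⟨h1, h2⟩ := abs_le.1 hw
      have h3 : w / (4 * K) ≤ 1 / 2 := by rw [div_le_iff₀ hK0]; linarith
      have h4 : -(1 / 2) ≤ w / (4 * K) := by rw [le_div_iff₀ hK0]; linarith
      exact hf' _ (by linarith) (by linarith)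
    have k1 := key (z 0 + -1 * z 1) (abs_le.2 ⟨by linarith, by linarith⟩)
    have k2 := key (z 0 + 1 * z 1) (abs_le.2 ⟨by linarith, by linarith⟩)
    simp only [Fin.sum_univ_two, Matrix.cons_val_zero, Matrix.cons_val_one,
      Matrix.cons_val_fin_one]
    have e : z 0 * z 1 = 4 * K ^ 2 * ((1 / 2 + (z 0 + -1 * z 1) / (4 * K)) *
          (1 - (1 / 2 + (z 0 + -1 * z 1) / (4 * K))) -
        (1 / 2 + (z 0 + 1 * z 1) / (4 * K)) * (1 - (1 / 2 + (z 0 + 1 * z 1) / (4 * K)))) := by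
      field_simp
      ring
    set u := 1 / 2 + (z 0 + -1 * z 1) / (4 * K)
    set v := 1 / 2 + (z 0 + 1 * z 1) / (4 * K)
    rw [e, show 4 * K ^ 2 * f (fun _ => u) + -(4 * K ^ 2) * f (fun _ => v) + 0 -
      4 * K ^ 2 * (u * (1 - u) - v * (1 - v)) =
      4 * K ^ 2 * ((f (fun _ => u) - u * (1 - u)) - (f (fun _ => v) - v * (1 - v))) by ring,
      abs_mul, abs_of_nonneg (by positivity)]
    have := abs_sub (f (fun _ => u) - u * (1 - u)) (f (fun _ => v) - v * (1 - v))
    nlinarith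

/-! ### Approximation of polynomials with few parameters -/

theorem div_rpow_neg {δ c η : ℝ} (hδ : 0 < δ) (hc : 0 < c) :
    (δ / c) ^ (-η) = c ^ η * δ ^ (-η) := by
  rw [Real.div_rpow hδ.le hc.le, Real.rpow_neg hc.le, div_inv_eq_mul, mul_comm]

theorem one_le_rpow_neg {δ η : ℝ} (hδ : 0 < δ) (hδ1 : δ ≤ 1) (hη : 0 ≤ η) : 1 ≤ δ ^ (-η) :=
  Real.one_le_rpow_of_pos_of_le_one_of_nonpos hδ hδ1 (by linarith)

/-- `NetApproxOn η K L C g`: on the cube `[-K, K]^ι` the function `g` is bounded by `C`, and it is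
approximated up to every error `δ ≤ 1` by a network with `L` hidden layers whose size and parameters
are at most `C δ ^ (-η)`. -/
def NetApproxOn (η K : ℝ) {ι : Type} [Fintype ι] (L : ℕ) (C : ℝ) (g : (ι → ℝ) → ℝ) : Prop :=
  (∀ x : ι → ℝ, (∀ i, |x i| ≤ K) → |g x| ≤ C) ∧
    ∀ δ : ℝ, 0 < δ → δ ≤ 1 → ∃ f : (ι → ℝ) → ℝ,
      ReluNet₁ L (C * δ ^ (-η)) (C * δ ^ (-η)) f ∧
        ∀ x : ι → ℝ, (∀ i, |x i| ≤ K) → |f x - g x| ≤ δ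

/-- Functions that are approximated on every cube, at bounded depth, by networks of size
`O(δ ^ (-η))` for the error `δ`. For every `η > 0` this holds for all polynomials. -/
def NetApprox (η : ℝ) {ι : Type} [Fintype ι] (g : (ι → ℝ) → ℝ) : Prop :=
  ∀ K : ℝ, ∃ (L : ℕ) (C : ℝ), NetApproxOn η K L C g

section

variable {ι : Type} [Fintype ι] {η : ℝ}

theorem NetApproxOn.mono {K C C' : ℝ} {L : ℕ} {g : (ι → ℝ) → ℝ} (h : NetApproxOn η K L C g)
    (hC : C ≤ C') : NetApproxOn η K L C' g := by
  refine ⟨fun x hx => (h.1 x hx).trans hC, fun δ h0 h1 => ?_⟩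
  obtain ⟨f, hf, hf'⟩ := h.2 δ h0 h1
  have : 0 ≤ δ ^ (-η) := (Real.rpow_pos_of_pos h0 _).le
  exact ⟨f, ReluNet.mono hf (by gcongr) (by gcongr), hf'⟩

theorem NetApproxOn.nonneg {K C : ℝ} {L : ℕ} {g : (ι → ℝ) → ℝ} (h : NetApproxOn η K L C g) :
    0 ≤ C := by
  obtain ⟨f, hf, -⟩ := h.2 1 one_pos le_rfl
  simpa using hf.size_nonneg

theorem NetApproxOn.pad (hη : 0 ≤ η) {K C : ℝ} {L : ℕ} {g : (ι → ℝ) → ℝ}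
    (h : NetApproxOn η K L C g) (n : ℕ) : NetApproxOn η K (L + n) (4 ^ n * (C + 2)) g := by
  have hC := h.nonneg
  have h4 : (1 : ℝ) ≤ 4 ^ n := one_le_pow₀ (by norm_num)
  refine ⟨fun x hx => (h.1 x hx).trans (by nlinarith), fun δ h0 h1 => ?_⟩
  obtain ⟨f, hf, hf'⟩ := h.2 δ h0 h1
  have hδ := one_le_rpow_neg h0 h1 hη
  have h5 : C * δ ^ (-η) ≤ 4 ^ n * (C + 2) * δ ^ (-η) := by
    gcongr; nlinarith
  have h6 : 1 ≤ 4 ^ n * (C + 2) * δ ^ (-η) := by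
    have : 1 ≤ 4 ^ n * (C + 2) := by nlinarith
    nlinarith
  refine ⟨f, ReluNet.mono ((ReluNet₁.mono hf le_rfl h5).pad h6 n) ?_ le_rfl, hf'⟩
  rw [mul_assoc]
  gcongr
  nlinarith

theorem netApprox_const (hη : 0 ≤ η) (c : ℝ) : NetApprox η fun _ : ι → ℝ => c := by
  refine fun K => ⟨0, |c| + 1 + Fintype.card ι, fun x _ => ?_, fun δ h0 h1 =>
    ⟨fun _ => c, ?_, fun x _ => by simpa using h0.le⟩⟩
  · have : (0 : ℝ) ≤ Fintype.card ι := by positivity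
    linarith
  · have hδ := one_le_rpow_neg h0 h1 hη
    have hn : (0 : ℝ) ≤ Fintype.card ι := by positivity
    have h := ReluNet₁.of_affine (ι := ι) (B := (|c| + 1 + Fintype.card ι) * δ ^ (-η))
      (a := fun _ => 0) (c := c) (by intro i; rw [abs_zero]; positivity)
      (by have := abs_nonneg c; nlinarith)
    simp only [zero_mul, Finset.sum_const_zero, zero_add] at h
    exact ReluNet.mono h (by have := abs_nonneg c; nlinarith) le_rfl

theorem netApprox_coord (hη : 0 ≤ η) (i : ι) : NetApprox η fun x : ι → ℝ => x i := by
  refine fun K => ⟨0, |K| + 2, fun x hx => ?_, fun δ h0 h1 =>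
    ⟨fun x => x i, ?_, fun x _ => by simpa using h0.le⟩⟩
  · have := hx i
    have := le_abs_self K
    linarith
  · have hδ := one_le_rpow_neg h0 h1 hη
    have hK := abs_nonneg K
    have h := ReluNet₁.coord (ι := ι) i (B := (|K| + 2) * δ ^ (-η)) (a := 1) (c := 0)
      (by rw [abs_one]; nlinarith) (by rw [abs_zero]; positivity)
    simp only [one_mul, add_zero] at h
    exact ReluNet.mono h (by nlinarith) le_rfl

/-- Composition with a function of two variables that is Lipschitz on bounded sets. -/
theorem NetApprox.comp₂ (hη : 0 ≤ η) {Φ : ℝ → ℝ → ℝ} {g₀ g₁ : (ι → ℝ) → ℝ}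
    (hΦ : NetApprox η fun z : Fin 2 → ℝ => Φ (z 0) (z 1))
    (hlip : ∀ K : ℝ, ∃ Λ : ℝ, 0 ≤ Λ ∧ ∀ a b a' b' : ℝ, |a| ≤ K → |b| ≤ K → |a'| ≤ K → |b'| ≤ K →
      |Φ a b - Φ a' b'| ≤ Λ * (|a - a'| + |b - b'|))
    (h₀ : NetApprox η g₀) (h₁ : NetApprox η g₁) : NetApprox η fun x => Φ (g₀ x) (g₁ x) := by
  intro K
  obtain ⟨L₀, C₀, h₀⟩ := h₀ K
  obtain ⟨L₁, C₁, h₁⟩ := h₁ K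
  replace h₀ := h₀.pad hη L₁
  replace h₁ := h₁.pad hη L₀
  rw [add_comm] at h₁
  set C := max (4 ^ L₁ * (C₀ + 2)) (4 ^ L₀ * (C₁ + 2)) with hC
  replace h₀ := h₀.mono (le_max_left _ (4 ^ L₀ * (C₁ + 2)))
  replace h₁ := h₁.mono (le_max_right (4 ^ L₁ * (C₀ + 2)) _)
  rw [← hC] at h₀ h₁
  have hC0 := h₀.nonneg
  obtain ⟨L₂, C₂, hΦ⟩ := hΦ (C + 1)
  have hC₂ := hΦ.nonneg
  obtain ⟨Λ, hΛ, hlip⟩ := hlip (C + 1)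
  -- the inner errors count with the factor `2 Λ`, the outer one with the factor `1`
  set c : ℝ := 2 * Λ + 1 with hc
  have hc1 : 1 ≤ c := by linarith
  set D : ℝ := (4 * C + 2 * C₂) * c ^ η with hD
  have hcη : 0 ≤ c ^ η := by positivity
  refine ⟨L₀ + L₁ + L₂ + 1, D + C₂, fun x hx => ?_, fun δ h0 h1 => ?_⟩
  · have := hΦ.1 ![g₀ x, g₁ x] (by
      intro i
      have := h₀.1 x hx
      have := h₁.1 x hx
      fin_cases i <;> simp <;> linarith)
    simp only [Matrix.cons_val_zero, Matrix.cons_val_one, Matrix.cons_val_fin_one] at this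
    have : 0 ≤ D := by positivity
    linarith
  · have hδc : 0 < δ / c := by positivity
    have hδc1 : δ / c ≤ 1 := (div_le_self h0.le hc1).trans h1
    obtain ⟨f₀, hf₀, hf₀'⟩ := h₀.2 _ hδc hδc1
    obtain ⟨f₁, hf₁, hf₁'⟩ := h₁.2 _ hδc hδc1
    obtain ⟨φ, hφ, hφ'⟩ := hΦ.2 _ hδc hδc1
    rw [div_rpow_neg h0 (by linarith)] at hf₀ hf₁ hφ
    have hδη : 0 ≤ δ ^ (-η) := by positivity
    have hp := ReluNet.pi (I := Fin 2) (f := ![f₀, f₁]) (L := L₀ + L₁)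
      (W := fun _ => C * (c ^ η * δ ^ (-η)))
      (B := C * (c ^ η * δ ^ (-η))) (by positivity) (by
        intro i
        fin_cases i
        exacts [hf₀, hf₁])
    have hB : C * (c ^ η * δ ^ (-η)) ≤ (D + C₂) * δ ^ (-η) := by
      rw [← mul_assoc, hD]
      gcongr
      nlinarith [mul_nonneg hC0 hcη, mul_nonneg hC₂ hcη]
    have hB' : C₂ * (c ^ η * δ ^ (-η)) ≤ (D + C₂) * δ ^ (-η) := by
      rw [← mul_assoc, hD]
      gcongr
      nlinarith [mul_nonneg hC0 hcη, mul_nonneg hC₂ hcη]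
    have hn := ReluNet.comp (ReluNet.mono hφ le_rfl hB') (ReluNet.mono hp le_rfl hB)
    refine ⟨_, ReluNet.mono hn ?_ le_rfl, ?_⟩
    · simp only [Finset.sum_const, Finset.card_univ, Fintype.card_fin, nsmul_eq_mul]
      rw [hD]
      push_cast
      have : 0 ≤ C₂ * δ ^ (-η) := by positivity
      nlinarith
    · intro x hx
      have b0 := h₀.1 x hx
      have b1 := h₁.1 x hx
      have e0 := hf₀' x hx
      have e1 := hf₁' x hx
      have B0 : |f₀ x| ≤ C + 1 := by
        have := abs_sub_abs_le_abs_sub (f₀ x) (g₀ x); linarith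
      have B1 : |f₁ x| ≤ C + 1 := by
        have := abs_sub_abs_le_abs_sub (f₁ x) (g₁ x); linarith
      have k1 := hφ' (fun i => ![f₀, f₁] i x) (by
        intro i
        fin_cases i
        exacts [B0, B1])
      simp only [Matrix.cons_val_zero, Matrix.cons_val_one, Matrix.cons_val_fin_one] at k1
      have k2 := hlip (f₀ x) (f₁ x) (g₀ x) (g₁ x) B0 B1 (by linarith) (by linarith)
      have k3 : Λ * (|f₀ x - g₀ x| + |f₁ x - g₁ x|) ≤ Λ * (δ / c + δ / c) := by gcongr
      have k4 := abs_sub_le (φ fun i => ![f₀, f₁] i x) (Φ (f₀ x) (f₁ x)) (Φ (g₀ x) (g₁ x))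
      have k5 : Λ * (δ / c + δ / c) + δ / c = δ := by
        rw [hc]; field_simp; ring
      linarith

theorem NetApprox.add (hη : 0 ≤ η) {g₀ g₁ : (ι → ℝ) → ℝ} (h₀ : NetApprox η g₀)
    (h₁ : NetApprox η g₁) : NetApprox η fun x => g₀ x + g₁ x := by
  refine NetApprox.comp₂ (Φ := fun a b => a + b) hη (fun K => ?_)
    (fun K => ⟨1, zero_le_one, fun a b a' b' _ _ _ _ => ?_⟩) h₀ h₁
  · refine ⟨0, 2 * |K| + 3, fun x hx => ?_, fun δ h0 h1 =>
      ⟨fun z => z 0 + z 1, ?_, fun x _ => by simpa using h0.le⟩⟩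
    · have := abs_add_le (x 0) (x 1)
      have := hx 0
      have := hx 1
      have := le_abs_self K
      linarith
    · have hδ := one_le_rpow_neg h0 h1 hη
      have hK := abs_nonneg K
      have h := ReluNet₁.of_affine (ι := Fin 2) (B := (2 * |K| + 3) * δ ^ (-η)) (a := fun _ => 1)
        (c := 0) (by intro i; rw [abs_one]; nlinarith) (by rw [abs_zero]; positivity)
      simp only [Fin.sum_univ_two, one_mul, add_zero, Fintype.card_fin] at h
      exact ReluNet.mono h (by push_cast; nlinarith) le_rfl
  · rw [one_mul, add_sub_add_comm]
    exact abs_add_le _ _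

/-- An error `δ` in the multiplication takes `m ≈ δ ^ (-η)` teeth and `k ≥ 1 / (2 η)` iterations of
the sawtooth; hence the depth is bounded. -/
theorem netApprox_mul_coord (hη : 0 < η) : NetApprox η fun z : Fin 2 → ℝ => z 0 * z 1 := by
  intro K₀
  set K := max 1 K₀
  have hK : 1 ≤ K := le_max_left _ _
  obtain ⟨k, hk⟩ := exists_nat_ge (1 / (2 * η))
  obtain ⟨L, C, hC, h⟩ := exists_reluNet_mul_pow k hK
  have hK0 : 0 < 8 * K ^ 2 := by positivity
  refine ⟨L, K ^ 2 + C * (2 * (8 * K ^ 2) ^ η), fun x hx => ?_, fun δ h0 h1 => ?_⟩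
  · have h2 : |x 0 * x 1| ≤ K * K := by
      rw [abs_mul]
      exact mul_le_mul ((hx 0).trans (le_max_right _ _)) ((hx 1).trans (le_max_right _ _))
        (abs_nonneg _) (by linarith)
    have : 0 ≤ C * (2 * (8 * K ^ 2) ^ η) := by positivity
    nlinarith
  · set δ' := δ / (8 * K ^ 2) with hδ'
    have hδ0 : 0 < δ' := by positivity
    have hδ1 : δ' ≤ 1 := (div_le_self h0.le (by nlinarith)).trans h1
    have hr := one_le_rpow_neg hδ0 hδ1 hη.le
    set m := ⌈δ' ^ (-η)⌉₊ with hm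
    have hm1 : δ' ^ (-η) ≤ m := Nat.le_ceil _
    have hm0 : m ≠ 0 := by
      intro h
      rw [h, Nat.cast_zero] at hm1
      linarith
    have hm2 : (m : ℝ) ≤ 2 * δ' ^ (-η) := by
      have := (Nat.ceil_lt_add_one (by linarith : 0 ≤ δ' ^ (-η))).le
      linarith
    obtain ⟨f, hf, hf'⟩ := h m hm0
    have hm3 : C * m ≤ (K ^ 2 + C * (2 * (8 * K ^ 2) ^ η)) * δ ^ (-η) := by
      rw [hδ', div_rpow_neg h0 hK0] at hm2
      have := mul_le_mul_of_nonneg_left hm2 hC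
      have : 0 ≤ K ^ 2 * δ ^ (-η) := by positivity
      linarith
    refine ⟨f, ReluNet.mono hf hm3 hm3, fun x hx => (hf' x fun i => (hx i).trans
      (le_max_right _ _)).trans ?_⟩
    have hpow : (((m : ℝ) ^ 2)⁻¹) ^ k ≤ δ' := by
      have hmpos : 0 < δ' ^ (-η) := by linarith
      calc (((m : ℝ) ^ 2)⁻¹) ^ k ≤ (((δ' ^ (-η)) ^ 2)⁻¹) ^ k := by gcongr
        _ = δ' ^ (2 * η * k) := by
          rw [← Real.rpow_natCast _ 2, ← Real.rpow_mul hδ0.le, ← Real.rpow_neg hδ0.le,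
            ← Real.rpow_natCast _ k, ← Real.rpow_mul hδ0.le]
          congr 1
          push_cast
          ring
        _ ≤ δ' ^ (1 : ℝ) := by
          refine Real.rpow_le_rpow_of_exponent_ge hδ0 hδ1 ?_
          rw [div_le_iff₀ (by positivity)] at hk
          linarith
        _ = δ' := Real.rpow_one _
    calc 8 * K ^ 2 * (((m : ℝ) ^ 2)⁻¹) ^ k ≤ 8 * K ^ 2 * δ' := by gcongr
      _ = δ := by rw [hδ']; field_simp

theorem NetApprox.mul (hη : 0 < η) {g₀ g₁ : (ι → ℝ) → ℝ} (h₀ : NetApprox η g₀)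
    (h₁ : NetApprox η g₁) : NetApprox η fun x => g₀ x * g₁ x := by
  refine NetApprox.comp₂ (Φ := fun a b => a * b) hη.le (netApprox_mul_coord hη)
    (fun K => ⟨|K|, abs_nonneg K, fun a b a' b' ha _ _ hb' => ?_⟩) h₀ h₁
  have h : a * b - a' * b' = a * (b - b') + b' * (a - a') := by ring
  have h2 := abs_add_le (a * (b - b')) (b' * (a - a'))
  rw [abs_mul, abs_mul] at h2
  have h3 := mul_le_mul_of_nonneg_right (ha.trans (le_abs_self K)) (abs_nonneg (b - b'))
  have h4 := mul_le_mul_of_nonneg_right (hb'.trans (le_abs_self K)) (abs_nonneg (a - a'))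
  rw [h]
  linarith

theorem NetApprox.sub (hη : 0 < η) {g₀ g₁ : (ι → ℝ) → ℝ} (h₀ : NetApprox η g₀)
    (h₁ : NetApprox η g₁) : NetApprox η fun x => g₀ x - g₁ x := by
  simpa [sub_eq_add_neg] using h₀.add hη.le (((netApprox_const hη.le (-1)).mul hη h₁))

theorem NetApprox.sum (hη : 0 ≤ η) {α : Type*} (s : Finset α) {g : α → (ι → ℝ) → ℝ}
    (h : ∀ a ∈ s, NetApprox η (g a)) : NetApprox η fun x => ∑ a ∈ s, g a x := by
  classical
  induction s using Finset.induction_on with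
  | empty => simpa using netApprox_const hη 0
  | insert a s ha ih =>
    simp only [Finset.sum_insert ha]
    exact (h a (Finset.mem_insert_self a s)).add hη
      (ih fun b hb => h b (Finset.mem_insert_of_mem hb))

theorem NetApprox.prod (hη : 0 < η) {α : Type*} (s : Finset α) {g : α → (ι → ℝ) → ℝ}
    (h : ∀ a ∈ s, NetApprox η (g a)) : NetApprox η fun x => ∏ a ∈ s, g a x := by
  classical
  induction s using Finset.induction_on with
  | empty => simpa using netApprox_const hη.le 1
  | insert a s ha ih =>
    simp only [Finset.prod_insert ha]
    exact (h a (Finset.mem_insert_self a s)).mul hη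
      (ih fun b hb => h b (Finset.mem_insert_of_mem hb))

end

/-! ### Bump functions -/

/-- A bump function that is `1` at sup-norm distance at most `ρ` from `a`, and `0` from the distance
`ρ + r` on. -/
noncomputable def gate {D : ℕ} (r ρ : ℝ) (a x : Fin D → ℝ) : ℝ :=
  max (1 - r⁻¹ * ∑ j, (max (x j - a j - ρ) 0 + max (a j - x j - ρ) 0)) 0

section

variable {D : ℕ} {r ρ : ℝ} {a x : Fin D → ℝ}

theorem gate_nonneg : 0 ≤ gate r ρ a x := le_max_right _ _

theorem gate_le_one (hr : 0 < r) : gate r ρ a x ≤ 1 := by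
  refine max_le ?_ zero_le_one
  have : 0 ≤ r⁻¹ * ∑ j, (max (x j - a j - ρ) 0 + max (a j - x j - ρ) 0) :=
    mul_nonneg (by positivity)
      (Finset.sum_nonneg fun j _ => add_nonneg (le_max_right _ _) (le_max_right _ _))
  linarith

theorem gate_eq_one (h : ∀ j, |x j - a j| ≤ ρ) : gate r ρ a x = 1 := by
  unfold gate
  rw [Finset.sum_eq_zero, mul_zero, sub_zero, max_eq_left zero_le_one]
  intro j _
  obtain ⟨h1, h2⟩ := abs_le.1 (h j)
  rw [max_eq_right (by linarith), max_eq_right (by linarith), add_zero]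

theorem gate_eq_zero (hr : 0 < r) {j : Fin D} (h : ρ + r ≤ |x j - a j|) : gate r ρ a x = 0 := by
  refine max_eq_right ?_
  have h1 : max (x j - a j - ρ) 0 + max (a j - x j - ρ) 0 ≤
      ∑ j, (max (x j - a j - ρ) 0 + max (a j - x j - ρ) 0) :=
    Finset.single_le_sum (f := fun j => max (x j - a j - ρ) 0 + max (a j - x j - ρ) 0)
      (fun j _ => add_nonneg (le_max_right _ _) (le_max_right _ _)) (Finset.mem_univ j)
  have h2 : r ≤ max (x j - a j - ρ) 0 + max (a j - x j - ρ) 0 := by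
    have h3 := le_max_left (x j - a j - ρ) 0
    have h4 := le_max_left (a j - x j - ρ) 0
    have h5 := le_max_right (x j - a j - ρ) 0
    have h6 := le_max_right (a j - x j - ρ) 0
    rcases abs_cases (x j - a j) with ⟨h, _⟩ | ⟨h, _⟩ <;> linarith
  have h3 : r⁻¹ * r ≤ r⁻¹ * ∑ j, (max (x j - a j - ρ) 0 + max (a j - x j - ρ) 0) := by
    gcongr
    exact h2.trans h1
  rw [inv_mul_cancel₀ hr.ne'] at h3
  linarith

theorem abs_sub_lt_of_gate_ne_zero (hr : 0 < r) (h : gate r ρ a x ≠ 0) (j : Fin D) :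
    |x j - a j| < ρ + r := by
  by_contra! h'
  exact h (gate_eq_zero hr h')

end

/-- A weighted sum of bump functions is a network with two hidden layers, whose size is
proportional to the number of bumps. -/
theorem reluNet_sum_gate {D : ℕ} {I : Type} [Fintype I] {r ρ B : ℝ} (hr : 0 < r) (hB : 2 ≤ B)
    (hrB : r⁻¹ ≤ B) (hρ : 0 ≤ ρ) (hρ1 : ρ ≤ 1) {a : I → Fin D → ℝ} (ha : ∀ i j, |a i j| ≤ 1)
    {v : I → ℝ} (hv : ∀ i, |v i| ≤ B) :
    ReluNet₁ 2 ((6 * D + 2) * Fintype.card I + 1) B fun x => ∑ i, v i * gate r ρ (a i) x := by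
  have hinv : 0 ≤ r⁻¹ := by positivity
  have h1 : ∀ i, ReluNet₁ (ι := Fin D) 1 (6 * D + 1) B fun x =>
      1 - r⁻¹ * ∑ j, (max (x j - a i j - ρ) 0 + max (a i j - x j - ρ) 0) := by
    intro i
    have h := ReluNet₁.relu (ι := Fin D) (I := Fin D ⊕ Fin D) (L := 0) (B := B) (W := fun _ => 2)
      (f := Sum.elim (fun j x => 1 * x j + (-(a i j + ρ))) fun j x => (-1) * x j + (a i j - ρ))
      (by linarith) (by
        rintro (j | j)
        · refine ReluNet₁.coord j (by rw [abs_one]; linarith) ?_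
          obtain ⟨h1, h2⟩ := abs_le.1 (ha i j)
          exact abs_le.2 ⟨by linarith, by linarith⟩
        · refine ReluNet₁.coord j (by rw [abs_neg, abs_one]; linarith) ?_
          obtain ⟨h1, h2⟩ := abs_le.1 (ha i j)
          exact abs_le.2 ⟨by linarith, by linarith⟩)
      (a := fun _ => -r⁻¹) (c := 1) (fun _ => by rwa [abs_neg, abs_of_nonneg hinv])
      (by rw [abs_one]; linarith)
    have e : (fun x : Fin D → ℝ =>
        1 - r⁻¹ * ∑ j, (max (x j - a i j - ρ) 0 + max (a i j - x j - ρ) 0)) = fun x =>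
        ∑ s, (-r⁻¹) * max ((Sum.elim (fun j x => 1 * x j + (-(a i j + ρ)))
          (fun j x => (-1) * x j + (a i j - ρ)) : Fin D ⊕ Fin D → (Fin D → ℝ) → ℝ) s x) 0 + 1 := by
      funext x
      rw [Fintype.sum_sum_type, ← Finset.mul_sum, ← Finset.mul_sum, Finset.sum_add_distrib]
      simp only [Sum.elim_inl, Sum.elim_inr]
      have e1 : ∀ j, 1 * x j + -(a i j + ρ) = x j - a i j - ρ := fun j => by ring
      have e2 : ∀ j, -1 * x j + (a i j - ρ) = a i j - x j - ρ := fun j => by ring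
      simp only [e1, e2]
      ring
    rw [e]
    refine ReluNet₁.mono h ?_ le_rfl
    simp only [Finset.sum_const, Finset.card_univ, Fintype.card_sum, Fintype.card_fin, nsmul_eq_mul]
    push_cast
    linarith
  have h2 := ReluNet₁.relu (by linarith) h1 hv (c := 0) (by rw [abs_zero]; linarith)
  simp only [add_zero] at h2
  refine ReluNet₁.mono h2 ?_ le_rfl
  simp only [Finset.sum_const, Finset.card_univ, nsmul_eq_mul]
  linarith

/-! ### Taylor expansion in Hölder balls -/

section holder

variable {D : ℕ}

theorem uniqueDiffOn_cube : UniqueDiffOn ℝ (cube D) := by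
  have : cube D = Set.pi Set.univ fun _ => Set.Icc (0 : ℝ) 1 := (Set.pi_univ_Icc _ _).symm
  rw [this]
  exact UniqueDiffOn.univ_pi fun _ => uniqueDiffOn_Icc zero_lt_one

theorem abs_le_one_of_mem_cube {x : Fin D → ℝ} (hx : x ∈ cube D) (j : Fin D) : |x j| ≤ 1 :=
  abs_le.2 ⟨by have := hx.1 j; simp at this; linarith, by simpa using hx.2 j⟩

theorem line_mem_cube {x h : Fin D → ℝ} (hx : x ∈ cube D) (hxh : x + h ∈ cube D) {t : ℝ}
    (ht : t ∈ Set.Icc (0 : ℝ) 1) : x + t • h ∈ cube D :=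
  (convex_Icc (0 : Fin D → ℝ) 1).add_smul_mem hx hxh ht

/-- Differentiation of a partial derivative along a segment. -/
theorem hasDerivWithinAt_line {n k : ℕ} (hk : k < n) {f : (Fin D → ℝ) → ℝ}
    (hf : ContDiffOn ℝ n f (cube D)) {x h : Fin D → ℝ} (hx : x ∈ cube D) (hxh : x + h ∈ cube D)
    (m : Fin k → Fin D → ℝ) {t : ℝ} (ht : t ∈ Set.Icc (0 : ℝ) 1) :
    HasDerivWithinAt (fun t : ℝ => iteratedFDerivWithin ℝ k f (cube D) (x + t • h) m)
      (iteratedFDerivWithin ℝ (k + 1) f (cube D) (x + t • h) (Fin.cons h m))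
      (Set.Icc 0 1) t := by
  have h1 := (hf.differentiableOn_iteratedFDerivWithin (m := k) (by exact_mod_cast hk)
    uniqueDiffOn_cube _ (line_mem_cube hx hxh ht)).hasFDerivWithinAt
  have h2 : HasDerivWithinAt (fun t : ℝ => x + t • h) h (Set.Icc 0 1) t := by
    simpa using ((hasDerivWithinAt_id t (Set.Icc (0 : ℝ) 1)).smul_const h).const_add x
  have h3 := h1.comp_hasDerivWithinAt t h2 fun s hs => line_mem_cube hx hxh hs
  have h4 := (ContinuousMultilinearMap.apply ℝ (fun _ : Fin k => Fin D → ℝ) ℝ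
    m).hasFDerivAt.comp_hasDerivWithinAt t h3
  rw [iteratedFDerivWithin_succ_apply_left]
  exact h4

theorem iteratedDerivWithin_line {n : ℕ} {f : (Fin D → ℝ) → ℝ} (hf : ContDiffOn ℝ n f (cube D))
    {x h : Fin D → ℝ} (hx : x ∈ cube D) (hxh : x + h ∈ cube D) {k : ℕ} (hk : k ≤ n) {t : ℝ}
    (ht : t ∈ Set.Icc (0 : ℝ) 1) :
    iteratedDerivWithin k (fun t : ℝ => f (x + t • h)) (Set.Icc 0 1) t =
      iteratedFDerivWithin ℝ k f (cube D) (x + t • h) fun _ => h := by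
  induction k generalizing t with
  | zero => simp
  | succ k ih =>
    have h1 := hasDerivWithinAt_line hk hf hx hxh (fun _ => h) ht
    have h2 : (Fin.cons h fun _ : Fin k => h : Fin (k + 1) → Fin D → ℝ) = fun _ => h := by
      funext i
      refine Fin.cases ?_ (fun i => ?_) i <;> simp
    rw [h2] at h1
    rw [iteratedDerivWithin_succ, ← h1.derivWithin (uniqueDiffOn_Icc zero_lt_one t ht)]
    exact derivWithin_congr (fun s hs => ih (Nat.le_of_succ_le hk) hs)
      (ih (Nat.le_of_succ_le hk) ht)

theorem iteratedFDerivWithin_apply_eq_sum {k : ℕ} (f : (Fin D → ℝ) → ℝ) (x h : Fin D → ℝ) :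
    (iteratedFDerivWithin ℝ k f (cube D) x fun _ => h) =
      ∑ v : Fin k → Fin D, cubePartial v f x * ∏ i, h (v i) := by
  have hh : h = ∑ j, h j • (Pi.single j 1 : Fin D → ℝ) := by
    funext i
    simp [Finset.sum_apply, Pi.single_apply]
  conv_lhs => rw [hh]
  rw [ContinuousMultilinearMap.map_sum]
  refine Finset.sum_congr rfl fun v _ => ?_
  rw [ContinuousMultilinearMap.map_smul_univ, smul_eq_mul, mul_comm]
  rfl

/-- The Taylor polynomial of order `n` with base point `a`, as a polynomial in the coefficients
`c v`, the point `x` and the base point `a`. The monomials of degree `k` are listed, with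
repetition, by the maps `v : Fin k → Fin D`. -/
noncomputable def taylorSum {n : ℕ} (c : (Σ k : Fin (n + 1), Fin k → Fin D) → ℝ)
    (a x : Fin D → ℝ) : ℝ :=
  ∑ v, c v * ∏ i, (x (v.2 i) - a (v.2 i))

/-- The Taylor coefficients of `f` at `a`. -/
noncomputable def taylorCoeff (n : ℕ) (f : (Fin D → ℝ) → ℝ) (a : Fin D → ℝ)
    (v : Σ k : Fin (n + 1), Fin k → Fin D) : ℝ :=
  ((v.1 : ℕ).factorial : ℝ)⁻¹ * cubePartial v.2 f a

theorem abs_prod_le {k : ℕ} (h : Fin D → ℝ) (v : Fin k → Fin D) : |∏ i, h (v i)| ≤ ‖h‖ ^ k := by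
  rw [Finset.abs_prod]
  calc ∏ i, |h (v i)| ≤ ∏ _i : Fin k, ‖h‖ :=
        Finset.prod_le_prod (fun _ _ => abs_nonneg _) fun i _ => norm_le_pi_norm h (v i)
    _ = ‖h‖ ^ k := by simp

theorem taylorSum_eq {n : ℕ} (f : (Fin D → ℝ) → ℝ) (a h : Fin D → ℝ) :
    taylorSum (taylorCoeff n f a) a (a + h) = ∑ k ∈ Finset.range (n + 1),
      ((k.factorial : ℝ)⁻¹) * iteratedFDerivWithin ℝ k f (cube D) a fun _ => h := by
  rw [taylorSum, Fintype.sum_sigma, ← Fin.sum_univ_eq_sum_range (fun k : ℕ =>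
    ((k.factorial : ℝ)⁻¹) * iteratedFDerivWithin ℝ k f (cube D) a fun _ => h)]
  refine Finset.sum_congr rfl fun k _ => ?_
  rw [iteratedFDerivWithin_apply_eq_sum, Finset.mul_sum]
  refine Finset.sum_congr rfl fun v _ => ?_
  simp [taylorCoeff, mul_assoc]

variable {β M : ℝ} {f : (Fin D → ℝ) → ℝ}

theorem abs_cubePartial_le (hM : 0 ≤ M) (hf : f ∈ holderBall β D M) {k : ℕ} (hk : (k : ℝ) < β)
    (v : Fin k → Fin D) {x : Fin D → ℝ} (hx : x ∈ cube D) : |cubePartial v f x| ≤ M := by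
  rw [← ENNReal.ofReal_le_ofReal_iff hM]
  refine le_trans ?_ hf.2
  refine le_trans ?_ le_self_add
  refine le_trans ?_ (le_iSup₂ k hk)
  refine le_trans ?_ (le_iSup _ v)
  exact le_iSup₂ (f := fun x (_ : x ∈ cube D) => ENNReal.ofReal |cubePartial v f x|) x hx

theorem abs_cubePartial_sub_le (hM : 0 ≤ M) (hf : f ∈ holderBall β D M) (v : Fin ⌊β⌋₊ → Fin D)
    {x y : Fin D → ℝ} (hx : x ∈ cube D) (hy : y ∈ cube D) :
    |cubePartial v f x - cubePartial v f y| ≤ M * ‖x - y‖ ^ (β - (⌊β⌋₊ : ℝ)) := by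
  rcases eq_or_ne x y with rfl | hxy
  · simp only [sub_self, abs_zero]
    positivity
  · have hpos : 0 < ‖x - y‖ ^ (β - (⌊β⌋₊ : ℝ)) :=
      Real.rpow_pos_of_pos (norm_pos_iff.2 (sub_ne_zero.2 hxy)) _
    rw [← div_le_iff₀ hpos, ← ENNReal.ofReal_le_ofReal_iff hM]
    refine le_trans ?_ hf.2
    refine le_trans ?_ le_add_self
    refine le_trans ?_ (le_iSup _ v)
    refine le_trans ?_ (le_iSup₂ x hx)
    refine le_trans ?_ (le_iSup₂ y hy)
    exact le_iSup (fun _ : x ≠ y => ENNReal.ofReal (|cubePartial v f x - cubePartial v f y| /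
      ‖x - y‖ ^ (β - (⌊β⌋₊ : ℝ)))) hxy

theorem abs_le_of_mem_holderBall (hβ : 0 < β) (hM : 0 ≤ M) (hf : f ∈ holderBall β D M)
    {x : Fin D → ℝ} (hx : x ∈ cube D) : |f x| ≤ M := by
  have := abs_cubePartial_le hM hf (k := 0) (by simpa using hβ) (fun i => i.elim0) hx
  simpa [cubePartial] using this

/-- The partial derivatives of top order are bounded too. If `β` is an integer this is not part of
the definition of the Hölder norm, but the derivatives of order `β` have oscillation at most `M`,
and by the mean value theorem each of them is at most `2 M` somewhere on a segment. -/
theorem abs_cubePartial_top_le (hβ : 0 < β) (hM : 0 ≤ M) (hf : f ∈ holderBall β D M)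
    {k : ℕ} (hk : k ≤ ⌊β⌋₊) (v : Fin k → Fin D) {x : Fin D → ℝ} (hx : x ∈ cube D) :
    |cubePartial v f x| ≤ 3 * M := by
  have hfl : (⌊β⌋₊ : ℝ) ≤ β := Nat.floor_le hβ.le
  rcases lt_or_ge (k : ℝ) β with h | h
  · have := abs_cubePartial_le hM hf h v hx
    linarith
  · have hkβ : (k : ℝ) = β := le_antisymm (le_trans (by exact_mod_cast hk) hfl) h
    have hk' : k = ⌊β⌋₊ := by rw [← hkβ, Nat.floor_natCast]
    obtain ⟨l, rfl⟩ : ∃ l, k = l + 1 := by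
      refine Nat.exists_eq_succ_of_ne_zero ?_
      rintro rfl
      simp at hkβ
      linarith
    have hl : (l : ℝ) < β := by rw [← hkβ]; push_cast; linarith
    set w := Fin.tail v
    set j := v 0
    set y : Fin D → ℝ := Function.update x j 0 with hy
    have hyc : y ∈ cube D := by
      constructor <;> intro i <;> rcases eq_or_ne i j with rfl | hi
      · simp [hy]
      · simpa [hy, hi] using hx.1 i
      · simp [hy]
      · simpa [hy, hi] using hx.2 i
    have hyc' : y + Pi.single j 1 ∈ cube D := by
      constructor <;> intro i <;> rcases eq_or_ne i j with rfl | hi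
      · simp [hy]
      · simpa [hy, hi] using hx.1 i
      · simp [hy]
      · simpa [hy, hi] using hx.2 i
    have hd : ∀ t ∈ Set.Icc (0 : ℝ) 1, HasDerivWithinAt
        (fun t : ℝ => cubePartial w f (y + t • Pi.single j 1))
        (cubePartial v f (y + t • Pi.single j 1)) (Set.Icc 0 1) t := by
      intro t ht
      have h1 := hasDerivWithinAt_line (k := l) (by omega) hf.1 hyc hyc'
        (fun i => Pi.single (w i) 1) ht
      have h2 : (Fin.cons (Pi.single j 1) fun i => Pi.single (w i) 1 :
          Fin (l + 1) → Fin D → ℝ) = fun i => Pi.single (v i) 1 := by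
        funext i
        refine Fin.cases ?_ (fun i => ?_) i <;> simp [w, j, Fin.tail]
      rwa [h2] at h1
    obtain ⟨t, ht, hslope⟩ := exists_hasDerivAt_eq_slope
      (fun t : ℝ => cubePartial w f (y + t • Pi.single j 1))
      (fun t : ℝ => cubePartial v f (y + t • Pi.single j 1)) zero_lt_one
      (fun t ht => (hd t ht).continuousWithinAt)
      (fun t ht => (hd t ⟨ht.1.le, ht.2.le⟩).hasDerivAt (Icc_mem_nhds ht.1 ht.2))
    have b1 := abs_cubePartial_le hM hf hl w (line_mem_cube hyc hyc' (t := 1) (by simp))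
    have b0 := abs_cubePartial_le hM hf hl w (line_mem_cube hyc hyc' (t := 0) (by simp))
    set z := y + t • (Pi.single j 1 : Fin D → ℝ)
    have hz : z ∈ cube D := line_mem_cube hyc hyc' ⟨ht.1.le, ht.2.le⟩
    have hosc : |cubePartial v f x - cubePartial v f z| ≤ M := by
      have key : ∀ {k : ℕ} (_ : k = ⌊β⌋₊) (v : Fin k → Fin D),
          |cubePartial v f x - cubePartial v f z| ≤ M * ‖x - z‖ ^ (β - (k : ℝ)) := by
        rintro k rfl v
        exact abs_cubePartial_sub_le hM hf v hx hz
      have := key hk' v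
      rwa [hkβ, sub_self, Real.rpow_zero, mul_one] at this
    have b2 : |cubePartial v f z| ≤ 2 * M := by
      rw [hslope, sub_zero, div_one]
      have := abs_sub (cubePartial w f (y + (1 : ℝ) • Pi.single j 1))
        (cubePartial w f (y + (0 : ℝ) • Pi.single j 1))
      linarith
    have := abs_sub_abs_le_abs_sub (cubePartial v f x) (cubePartial v f z)
    linarith

theorem abs_taylorCoeff_le (hβ : 0 < β) (hM : 0 ≤ M) (hf : f ∈ holderBall β D M) {a : Fin D → ℝ}
    (ha : a ∈ cube D) (v : Σ k : Fin (⌊β⌋₊ + 1), Fin k → Fin D) :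
    |taylorCoeff ⌊β⌋₊ f a v| ≤ 3 * M := by
  rw [taylorCoeff, abs_mul, abs_of_nonneg (by positivity)]
  have h1 := abs_cubePartial_top_le hβ hM hf (Nat.lt_succ_iff.1 v.1.2) v.2 ha
  have h2 : ((v.1 : ℕ).factorial : ℝ)⁻¹ ≤ 1 :=
    inv_le_one_of_one_le₀ (by exact_mod_cast Nat.factorial_pos _)
  calc _ ≤ 1 * (3 * M) := by gcongr
    _ = _ := one_mul _

/-- The error of the Taylor polynomial of order `⌊β⌋`. The Lagrange remainder of order `⌊β⌋ - 1` is
compared with the terms of order `⌊β⌋`. -/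
theorem abs_sub_taylorSum_le (hβ : 0 < β) (hM : 0 ≤ M) (hf : f ∈ holderBall β D M)
    {a x : Fin D → ℝ} (ha : a ∈ cube D) (hx : x ∈ cube D) :
    |f x - taylorSum (taylorCoeff ⌊β⌋₊ f a) a x| ≤ (D : ℝ) ^ ⌊β⌋₊ * M * ‖x - a‖ ^ β := by
  obtain ⟨h, rfl⟩ : ∃ h, x = a + h := ⟨x - a, by abel⟩
  have hfl : (⌊β⌋₊ : ℝ) ≤ β := Nat.floor_le hβ.le
  obtain ⟨t, ht, hrem⟩ : ∃ t ∈ Set.Icc (0 : ℝ) 1,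
      f (a + h) - taylorSum (taylorCoeff ⌊β⌋₊ f a) a (a + h) =
        ((⌊β⌋₊.factorial : ℝ)⁻¹) *
          ((iteratedFDerivWithin ℝ ⌊β⌋₊ f (cube D) (a + t • h) fun _ => h) -
            iteratedFDerivWithin ℝ ⌊β⌋₊ f (cube D) a fun _ => h) := by
    rw [taylorSum_eq, Finset.sum_range_succ]
    have hcont := hf.1
    generalize ⌊β⌋₊ = n at hcont
    cases n with
    | zero => exact ⟨1, by simp, by simp⟩
    | succ n =>
      have hG := fun {k : ℕ} (hk : k ≤ n + 1) {t : ℝ} (ht : t ∈ Set.Icc (0 : ℝ) 1) =>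
        iteratedDerivWithin_line hcont ha hx hk ht
      have hsmooth : ContDiffOn ℝ (n + 1 : ℕ) (fun t : ℝ => f (a + t • h)) (Set.Icc 0 1) :=
        hcont.comp (by fun_prop) fun t ht => line_mem_cube ha hx ht
      have hI : Set.uIcc (0 : ℝ) 1 = Set.Icc 0 1 := Set.uIcc_of_le zero_le_one
      obtain ⟨t, ht, hL⟩ := taylor_mean_remainder_lagrange (f := fun t : ℝ => f (a + t • h))
        (x := 1) (x₀ := 0) (n := n) zero_ne_one
        (by rw [hI]; exact hsmooth.of_le (by exact_mod_cast Nat.le_succ n))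
        (by
          rw [hI]
          exact (hsmooth.differentiableOn_iteratedDerivWithin (by exact_mod_cast Nat.lt_succ_self n)
            (uniqueDiffOn_Icc zero_lt_one)).mono
              (by rw [← hI]; exact Set.uIoo_subset_uIcc_self))
      have ht' : t ∈ Set.Icc (0 : ℝ) 1 := by
        rw [← hI]; exact Set.uIoo_subset_uIcc_self ht
      refine ⟨t, ht', ?_⟩
      rw [hI, taylor_within_apply, hG le_rfl ht'] at hL
      have hsum : ∑ k ∈ Finset.range (n + 1), ((k.factorial : ℝ)⁻¹ * (1 - 0) ^ k) •
          iteratedDerivWithin k (fun t : ℝ => f (a + t • h)) (Set.Icc 0 1) 0 =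
          ∑ k ∈ Finset.range (n + 1), ((k.factorial : ℝ)⁻¹) *
            iteratedFDerivWithin ℝ k f (cube D) a fun _ => h := by
        refine Finset.sum_congr rfl fun k hk => ?_
        rw [hG (Finset.mem_range.1 hk).le (by simp)]
        simp
      rw [hsum] at hL
      simp only [one_smul, sub_zero, one_pow, mul_one] at hL
      rw [mul_sub, ← sub_sub, hL, div_eq_inv_mul]
  have hline := line_mem_cube ha hx ht
  rw [hrem, iteratedFDerivWithin_apply_eq_sum, iteratedFDerivWithin_apply_eq_sum,
    ← Finset.sum_sub_distrib, abs_mul, abs_of_nonneg (by positivity), add_sub_cancel_left]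
  have hterm : ∀ v : Fin ⌊β⌋₊ → Fin D,
      |cubePartial v f (a + t • h) * ∏ i, h (v i) - cubePartial v f a * ∏ i, h (v i)| ≤
        M * ‖h‖ ^ β := by
    intro v
    rw [← sub_mul, abs_mul]
    have h1 := abs_cubePartial_sub_le hM hf v hline ha
    have h2 : ‖a + t • h - a‖ ≤ ‖h‖ := by
      rw [add_sub_cancel_left, norm_smul, Real.norm_eq_abs, abs_of_nonneg ht.1]
      exact mul_le_of_le_one_left (norm_nonneg _) ht.2
    calc _ ≤ M * ‖h‖ ^ (β - (⌊β⌋₊ : ℝ)) * ‖h‖ ^ ⌊β⌋₊ := by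
          refine mul_le_mul (h1.trans ?_) (abs_prod_le h v) (abs_nonneg _) (by positivity)
          gcongr
      _ = M * ‖h‖ ^ β := by
        rw [mul_assoc, ← Real.rpow_natCast,
          ← Real.rpow_add' (norm_nonneg _) (by simpa using hβ.ne')]
        simp
  have hfac : ((⌊β⌋₊.factorial : ℝ)⁻¹) ≤ 1 :=
    inv_le_one_of_one_le₀ (by exact_mod_cast Nat.factorial_pos _)
  calc _ ≤ 1 * ∑ v : Fin ⌊β⌋₊ → Fin D, M * ‖h‖ ^ β := by
        refine mul_le_mul hfac ?_ (abs_nonneg _) zero_le_one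
        exact (Finset.abs_sum_le_sum_abs _ _).trans (Finset.sum_le_sum fun v _ => hterm v)
    _ = _ := by simp [mul_assoc]

end holder

/-! ### Counting cells -/

section cells

variable {D : ℕ} {S : Set (Fin D → ℝ)}

theorem exists_finset_cover {r : ℝ≥0} (h : Metric.externalCoveringNumber r S ≠ ⊤) :
    ∃ T : Finset (Fin D → ℝ), ((T.card : ℕ∞) ≤ Metric.externalCoveringNumber r S) ∧
      ∀ x ∈ S, ∃ y ∈ T, ∀ j, |x j - y j| ≤ r := by
  have h1 : Metric.externalCoveringNumber r S < Metric.externalCoveringNumber r S + 1 :=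
    (ENat.lt_add_one_iff h).2 le_rfl
  obtain ⟨T, hT, hc⟩ : ∃ T : Set (Fin D → ℝ), Metric.IsCover r S T ∧
      T.encard < Metric.externalCoveringNumber r S + 1 := by
    conv at h1 => lhs; unfold Metric.externalCoveringNumber
    simpa [iInf_lt_iff] using h1
  rw [ENat.lt_add_one_iff h] at hc
  have hfin : T.Finite := Set.encard_ne_top_iff.1 (ne_top_of_le_ne_top h hc)
  refine ⟨hfin.toFinset, by rwa [← hfin.encard_eq_coe_toFinset_card], fun x hx => ?_⟩
  have := Metric.isCover_iff_subset_iUnion_closedBall.1 hT hx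
  simp only [Set.mem_iUnion, exists_prop] at this
  obtain ⟨y, hy, hxy⟩ := this
  refine ⟨y, by simpa using hy, fun j => ?_⟩
  rw [Metric.mem_closedBall, dist_eq_norm] at hxy
  exact (norm_le_pi_norm (x - y) j).trans hxy

/-- The upper Minkowski dimension hypothesis in quantitative form: the set is covered by
`O(r ^ (-d))` balls of radius `r ≤ 1`. -/
theorem exists_cover_bound {d : ℝ≥0} (hdim : upperMinkowskiDim S ≤ (d : ℝ≥0∞))
    (hcrit : upperMinkowskiDim S = (d : ℝ≥0∞) →
      limsup (coverMass S d) (𝓝[>] (0 : ℝ≥0)) < ⊤) :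
    ∃ C : ℝ, 0 ≤ C ∧ ∀ r : ℝ, 0 < r → r ≤ 1 → ∃ T : Finset (Fin D → ℝ),
      (T.card : ℝ) ≤ C * r ^ (-(d : ℝ)) ∧ ∀ x ∈ S, ∃ y ∈ T, ∀ j, |x j - y j| ≤ r := by
  have hlim : limsup (coverMass S d) (𝓝[>] (0 : ℝ≥0)) < ⊤ := by
    rcases hdim.lt_or_eq with h | h
    · unfold upperMinkowskiDim at h
      simp only [iInf_lt_iff] at h
      obtain ⟨e, he, hed⟩ := h
      have hed' : e ≤ d := by exact_mod_cast hed.le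
      refine lt_of_le_of_lt ?_ ENNReal.zero_lt_top
      rw [← he]
      refine limsup_le_limsup ?_
      have h1 : ∀ᶠ r : ℝ≥0 in 𝓝[>] (0 : ℝ≥0), r < 1 :=
        nhdsWithin_le_nhds (Iio_mem_nhds zero_lt_one)
      filter_upwards [h1] with r hr
      unfold coverMass
      refine mul_le_mul' le_rfl ?_
      have hr' : (r : ℝ≥0∞) ≤ 1 := by exact_mod_cast hr.le
      exact ENNReal.rpow_le_rpow_of_exponent_ge hr' (by exact_mod_cast hed')
    · exact hcrit h
  obtain ⟨c, hc1, hc2⟩ := exists_between hlim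
  have hev := eventually_lt_of_limsup_lt hc1
  lift c to ℝ≥0 using hc2.ne
  obtain ⟨r₀, hr₀, hsub⟩ := mem_nhdsGT_iff_exists_Ioo_subset.1 hev
  have small : ∀ r : ℝ, 0 < r → r < r₀ → ∃ T : Finset (Fin D → ℝ),
      (T.card : ℝ) ≤ c * r ^ (-(d : ℝ)) ∧ ∀ x ∈ S, ∃ y ∈ T, ∀ j, |x j - y j| ≤ r := by
    intro r hr hr'
    lift r to ℝ≥0 using hr.le
    have h1 : coverMass S d r < c := hsub ⟨by exact_mod_cast hr, by exact_mod_cast hr'⟩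
    have hr0 : r ≠ 0 := by
      rintro rfl
      simp at hr
    have hpow' : (r : ℝ≥0∞) ^ (d : ℝ) = ((r ^ (d : ℝ) : ℝ≥0) : ℝ≥0∞) :=
      (ENNReal.coe_rpow_of_ne_zero hr0 _).symm
    have hpow : (r : ℝ≥0∞) ^ (d : ℝ) ≠ 0 := by
      rw [hpow']
      exact ENNReal.coe_ne_zero.2 (NNReal.rpow_pos (pos_iff_ne_zero.2 hr0)).ne'
    unfold coverMass at h1
    have hN : Metric.externalCoveringNumber r S ≠ ⊤ := by
      intro h
      rw [h, ENat.toENNReal_top, ENNReal.top_mul hpow] at h1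
      exact not_top_lt h1
    obtain ⟨T, hT, hcov⟩ := exists_finset_cover hN
    refine ⟨T, ?_, hcov⟩
    have h2 : ((T.card : ℝ≥0) : ℝ≥0∞) * ((r ^ (d : ℝ) : ℝ≥0) : ℝ≥0∞) ≤ c := by
      rw [← hpow']
      refine le_trans ?_ h1.le
      gcongr
      have := ENat.toENNReal_le.2 hT
      simpa using this
    have h3 : (T.card : ℝ≥0) * r ^ (d : ℝ) ≤ c := by exact_mod_cast h2
    have h4 : (T.card : ℝ) * (r : ℝ) ^ (d : ℝ) ≤ c := by exact_mod_cast h3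
    rw [Real.rpow_neg r.coe_nonneg, ← div_eq_mul_inv, le_div_iff₀ (Real.rpow_pos_of_pos hr _)]
    exact h4
  have hr₀' : (0 : ℝ) < r₀ := by exact_mod_cast hr₀
  obtain ⟨T₀, -, hT₀⟩ := small (r₀ / 2) (by linarith) (by linarith)
  refine ⟨max c T₀.card, by positivity, fun r hr hr1 => ?_⟩
  have hrd : 1 ≤ r ^ (-(d : ℝ)) :=
    Real.one_le_rpow_of_pos_of_le_one_of_nonpos hr hr1 (by simp)
  rcases lt_or_ge r r₀ with h | h
  · obtain ⟨T, hT, hcov⟩ := small r hr h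
    exact ⟨T, hT.trans (by gcongr; exact le_max_left _ _), hcov⟩
  · refine ⟨T₀, ?_, fun x hx => ?_⟩
    · have := le_max_right (c : ℝ) T₀.card
      have h0 : (0 : ℝ) ≤ T₀.card := by positivity
      nlinarith
    · obtain ⟨y, hy, hxy⟩ := hT₀ x hx
      exact ⟨y, hy, fun j => (hxy j).trans (by linarith)⟩

/-- The index of the cell of side `r` that contains `x`. -/
noncomputable def cellIndex (r : ℝ) (x : Fin D → ℝ) : Fin D → ℤ := fun j => ⌊x j / r⌋

theorem abs_sub_lt_of_cellIndex_eq {r : ℝ} (hr : 0 < r) {x y : Fin D → ℝ}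
    (h : cellIndex r x = cellIndex r y) (j : Fin D) : |x j - y j| < r := by
  have h1 := Int.abs_sub_lt_one_of_floor_eq_floor (congrFun h j)
  rwa [← sub_div, abs_div, abs_of_pos hr, div_lt_one hr] at h1

/-- Points whose cell indices differ by at least `k + 1` are more than `k` sides apart. -/
theorem lt_abs_sub_of_cellIndex {r : ℝ} (hr : 0 < r) {x y : Fin D → ℝ} {j : Fin D} {k : ℕ}
    (h : (k : ℤ) + 1 ≤ |cellIndex r x j - cellIndex r y j|) : k * r < |x j - y j| := by
  have a1 := Int.floor_le (x j / r)
  have a2 := Int.lt_floor_add_one (x j / r)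
  have b1 := Int.floor_le (y j / r)
  have b2 := Int.lt_floor_add_one (y j / r)
  have h' : (k : ℝ) + 1 ≤ |(⌊x j / r⌋ : ℝ) - ⌊y j / r⌋| := by exact_mod_cast h
  have h1 : (k : ℝ) < |x j / r - y j / r| := by
    rcases abs_cases ((⌊x j / r⌋ : ℝ) - ⌊y j / r⌋) with ⟨e, _⟩ | ⟨e, _⟩
    · exact lt_of_lt_of_le (by linarith) (le_abs_self _)
    · exact lt_of_lt_of_le (by linarith) (neg_le_abs _)
  rwa [← sub_div, abs_div, abs_of_pos hr, lt_div_iff₀ hr] at h1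

/-- A ball of radius `r` meets at most `3 ^ D` cells of side `r`. -/
theorem exists_cells {d : ℝ} (hcov : ∃ C : ℝ, 0 ≤ C ∧ ∀ r : ℝ, 0 < r → r ≤ 1 →
      ∃ T : Finset (Fin D → ℝ), (T.card : ℝ) ≤ C * r ^ (-d) ∧
        ∀ x ∈ S, ∃ y ∈ T, ∀ j, |x j - y j| ≤ r) :
    ∃ C : ℝ, 0 ≤ C ∧ ∀ r : ℝ, 0 < r → r ≤ 1 → ∃ Z : Finset (Fin D → ℤ),
      (Z.card : ℝ) ≤ C * r ^ (-d) ∧ (∀ x ∈ S, cellIndex r x ∈ Z) ∧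
        ∀ z ∈ Z, ∃ x ∈ S, cellIndex r x = z := by
  classical
  obtain ⟨C, hC, h⟩ := hcov
  refine ⟨3 ^ D * C, by positivity, fun r hr hr1 => ?_⟩
  obtain ⟨T, hT, hTS⟩ := h r hr hr1
  set E : Finset (Fin D → ℤ) := Fintype.piFinset fun _ => Finset.Icc (-1) 1 with hE
  have hEcard : E.card = 3 ^ D := by simp [hE]
  set Z₀ := (T ×ˢ E).image fun q => cellIndex r q.1 + q.2 with hZ₀
  have hmem : ∀ x ∈ S, cellIndex r x ∈ Z₀ := by
    intro x hx
    obtain ⟨y, hy, hxy⟩ := hTS x hx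
    refine Finset.mem_image.2 ⟨(y, cellIndex r x - cellIndex r y),
      Finset.mem_product.2 ⟨hy, ?_⟩, by simp⟩
    rw [hE, Fintype.mem_piFinset]
    intro j
    rw [Finset.mem_Icc, ← abs_le]
    by_contra! hlt
    have := lt_abs_sub_of_cellIndex (k := 1) hr (Int.add_one_le_iff.2 (by exact_mod_cast hlt))
    have := hxy j
    push_cast at *
    linarith
  refine ⟨Z₀.filter fun z => ∃ x ∈ S, cellIndex r x = z, ?_,
    fun x hx => Finset.mem_filter.2 ⟨hmem x hx, x, hx, rfl⟩,
    fun z hz => (Finset.mem_filter.1 hz).2⟩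
  have h1 : (Z₀.filter fun z => ∃ x ∈ S, cellIndex r x = z).card ≤ T.card * 3 ^ D :=
    (Finset.card_filter_le _ _).trans (Finset.card_image_le.trans (by
      rw [Finset.card_product, hEcard]))
  calc (((Z₀.filter fun z => ∃ x ∈ S, cellIndex r x = z).card : ℕ) : ℝ) ≤ T.card * 3 ^ D := by
        exact_mod_cast h1
    _ ≤ C * r ^ (-d) * 3 ^ D := by gcongr
    _ = _ := by ring

theorem exists_separation (s : Finset (Fin D → ℝ)) : ∃ r : ℝ, 0 < r ∧ r ≤ 1 ∧
    ∀ x ∈ s, ∀ y ∈ s, x ≠ y → ∃ j, r ≤ |x j - y j| := by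
  have h : ∀ᶠ r : ℝ in 𝓝[>] 0, ∀ x ∈ s, ∀ y ∈ s, x ≠ y → ∃ j, r ≤ |x j - y j| := by
    rw [eventually_all_finset]
    intro x _
    rw [eventually_all_finset]
    intro y _
    by_cases hxy : x = y
    · exact Eventually.of_forall fun r hr => absurd hxy hr
    · obtain ⟨j, hj⟩ := Function.ne_iff.1 hxy
      have : 0 < |x j - y j| := abs_pos.2 (sub_ne_zero.2 hj)
      filter_upwards [nhdsWithin_le_nhds (Iio_mem_nhds this)] with r hr _
      exact ⟨j, le_of_lt hr⟩
  have h1 : ∀ᶠ r : ℝ in 𝓝[>] 0, r < 1 := nhdsWithin_le_nhds (Iio_mem_nhds zero_lt_one)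
  obtain ⟨r, hr, hr1, hr0⟩ := (h.and (h1.and self_mem_nhdsWithin)).exists
  exact ⟨r, hr0, hr1.le, hr⟩

/-- A set that meets boundedly many cells of each side `r` is finite, since the cells separate any
finitely many points once `r` is small. -/
theorem finite_of_cells {C : ℝ} (h : ∀ r : ℝ, 0 < r → r ≤ 1 → ∃ Z : Finset (Fin D → ℤ),
    (Z.card : ℝ) ≤ C ∧ ∀ x ∈ S, cellIndex r x ∈ Z) : S.Finite := by
  by_contra hinf
  obtain ⟨n, hn⟩ := exists_nat_gt C
  obtain ⟨s, hsS, hs⟩ := Set.Infinite.exists_subset_card_eq hinf n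
  obtain ⟨r, hr, hr1, hsep⟩ := exists_separation s
  obtain ⟨Z, hZ, hmem⟩ := h r hr hr1
  have : s.card ≤ Z.card := by
    refine Finset.card_le_card_of_injOn (cellIndex r) (fun x hx => hmem x (hsS hx)) ?_
    intro x hx y hy hxy
    by_contra hne
    obtain ⟨j, hj⟩ := hsep x hx y hy hne
    exact absurd (abs_sub_lt_of_cellIndex_eq hr hxy j) (not_lt.2 hj)
  have : (s.card : ℝ) ≤ Z.card := by exact_mod_cast this
  rw [hs] at this
  linarith

end cells

/-! ### Blending local approximations -/

/-- Local approximations `P k`, each of them valid where the weight `χ k` is nonzero, are blended by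
the recursion `Q ↦ Q + χ k (P k - Q)`. Once some weight `1` has been met, all later steps are convex
combinations of accurate values. The blend `Q` is a polynomial expression in the `χ k` and `P k`. -/
theorem exists_blend {ι : Type} [Fintype ι] {η : ℝ} (hη : 0 < η) {K : Type*}
    {χ P : K → (ι → ℝ) → ℝ} (hχ : ∀ k, NetApprox η (χ k)) (hP : ∀ k, NetApprox η (P k))
    (U : Finset K) :
    ∃ Q : (ι → ℝ) → ℝ, NetApprox η Q ∧ ∀ (z : ι → ℝ) (y e : ℝ),
      (∀ k, 0 ≤ χ k z ∧ χ k z ≤ 1) → (∀ k, χ k z ≠ 0 → |P k z - y| ≤ e) →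
        (∃ k ∈ U, χ k z = 1) → |Q z - y| ≤ e := by
  classical
  induction U using Finset.induction_on with
  | empty => exact ⟨fun _ => 0, netApprox_const hη.le 0, by simp⟩
  | insert k₀ U _ ih =>
    obtain ⟨Q, hQ, hQ'⟩ := ih
    refine ⟨fun z => Q z + χ k₀ z * (P k₀ z - Q z),
      hQ.add hη.le ((hχ k₀).mul hη ((hP k₀).sub hη hQ)), fun z y e h01 hloc hex => ?_⟩
    dsimp only
    by_cases h1 : χ k₀ z = 1
    · have := hloc k₀ (by rw [h1]; exact one_ne_zero)
      rwa [h1, one_mul, add_sub_cancel]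
    · have hQe : |Q z - y| ≤ e := by
        refine hQ' z y e h01 hloc ?_
        obtain ⟨k, hk, hk1⟩ := hex
        rcases Finset.mem_insert.1 hk with rfl | hk
        · exact absurd hk1 h1
        · exact ⟨k, hk, hk1⟩
      by_cases h0 : χ k₀ z = 0
      · rwa [h0, zero_mul, add_zero]
      · obtain ⟨a1, a2⟩ := abs_le.1 (hloc k₀ h0)
        obtain ⟨b1, b2⟩ := abs_le.1 hQe
        obtain ⟨c1, c2⟩ := h01 k₀
        rw [abs_le]
        constructor <;> nlinarith

/-! ### Selecting the data of a cell -/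

section selector

variable {D : ℕ} {I K : Type} [Fintype I] [DecidableEq K]

/-- The sum of the bumps of colour `k`, with weights `v`. If the centres of colour `k` are well
separated, this selects the weight of the centre of colour `k` near `x`. -/
noncomputable def selector (r ρ : ℝ) (a : I → Fin D → ℝ) (col : I → K) (v : I → ℝ) (k : K)
    (x : Fin D → ℝ) : ℝ :=
  ∑ i, (if col i = k then v i else 0) * gate r ρ (a i) x

variable {r ρ : ℝ} {a : I → Fin D → ℝ} {col : I → K} {v : I → ℝ} {x : Fin D → ℝ}

theorem selector_eq (hr : 0 < r) (hρ : ρ ≤ 2 * r)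
    (hsep : ∀ i i', col i = col i' → i ≠ i' → ∃ j, 6 * r ≤ |a i j - a i' j|) {i₀ : I}
    (hi₀ : gate r (2 * r) (a i₀) x ≠ 0) :
    selector r ρ a col v (col i₀) x = v i₀ * gate r ρ (a i₀) x := by
  unfold selector
  rw [Finset.sum_eq_single i₀]
  · simp
  · intro i _ hi
    by_cases hc : col i = col i₀
    · obtain ⟨j, hj⟩ := hsep i i₀ hc hi
      have h1 := abs_sub_lt_of_gate_ne_zero hr hi₀ j
      have h2 : ρ + r ≤ |x j - a i j| := by
        have := abs_sub_le (a i j) (x j) (a i₀ j)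
        rw [abs_sub_comm (a i j) (x j)] at this
        linarith
      rw [gate_eq_zero hr h2, mul_zero]
    · rw [if_neg hc, zero_mul]
  · simp

theorem exists_gate_ne_zero_of_selector_ne_zero {k : K} (h : selector r ρ a col v k x ≠ 0) :
    ∃ i, col i = k ∧ gate r ρ (a i) x ≠ 0 := by
  obtain ⟨i, -, hi⟩ := Finset.exists_ne_zero_of_sum_ne_zero h
  obtain ⟨h1, h2⟩ := mul_ne_zero_iff.1 hi
  exact ⟨i, by_contra fun hc => h1 (if_neg hc), h2⟩

theorem gate_mono (hr : 0 < r) {ρ' : ℝ} (h : ρ ≤ ρ') {a : Fin D → ℝ} :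
    gate r ρ a x ≤ gate r ρ' a x := by
  unfold gate
  gcongr

theorem gate_ne_zero_mono (hr : 0 < r) {ρ' : ℝ} (h : ρ ≤ ρ') {a : Fin D → ℝ}
    (h0 : gate r ρ a x ≠ 0) : gate r ρ' a x ≠ 0 :=
  ((gate_nonneg.lt_of_ne' h0).trans_le (gate_mono hr h)).ne'

theorem abs_selector_le (hr : 0 < r) (hρ : ρ ≤ 2 * r)
    (hsep : ∀ i i', col i = col i' → i ≠ i' → ∃ j, 6 * r ≤ |a i j - a i' j|) {V : ℝ} (hV : 0 ≤ V)
    (hv : ∀ i, |v i| ≤ V) (k : K) : |selector r ρ a col v k x| ≤ V := by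
  by_cases h : selector r ρ a col v k x = 0
  · rwa [h, abs_zero]
  · obtain ⟨i, rfl, hi⟩ := exists_gate_ne_zero_of_selector_ne_zero h
    rw [selector_eq hr hρ hsep (gate_ne_zero_mono hr hρ hi), abs_mul, abs_of_nonneg gate_nonneg]
    calc _ ≤ V * 1 := mul_le_mul (hv i) (gate_le_one hr) gate_nonneg hV
      _ = V := mul_one V

theorem reluNet_selector {B V : ℝ} (hr : 0 < r) (hB : 2 ≤ B) (hrB : r⁻¹ ≤ B) (hρ : 0 ≤ ρ)
    (hρ1 : ρ ≤ 1) (ha : ∀ i j, |a i j| ≤ 1) (hv : ∀ i, |v i| ≤ V) (hVB : V ≤ B) (k : K) :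
    ReluNet₁ 2 ((6 * D + 2) * Fintype.card I + 1) B (selector r ρ a col v k) :=
  reluNet_sum_gate hr hB hrB hρ hρ1 ha fun i => by
    split_ifs
    · exact (hv i).trans hVB
    · rw [abs_zero]; linarith

end selector

/-! ### Approximation of Hölder functions on low-dimensional sets -/

/-- The indices of the features extracted by the first layers: for every colour the weight of the
local approximation, the coordinates of the selected centre, and the Taylor coefficients there;
and finally the coordinates of the point itself. -/
abbrev Feature (D n : ℕ) (K : Type) : Type :=
  K ⊕ (K × Fin D) ⊕ (K × Σ k : Fin (n + 1), Fin k → Fin D) ⊕ Fin D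

section features

variable {D n : ℕ} {I K : Type} [Fintype I] [DecidableEq K]

/-- The features of `x`. The bumps for the centres and coefficients are wider than those for the
weights, so that the former are selected exactly wherever the weight is nonzero. -/
noncomputable def features (r : ℝ) (a : I → Fin D → ℝ) (col : I → K) (f : (Fin D → ℝ) → ℝ)
    (x : Fin D → ℝ) : Feature D n K → ℝ
  | .inl k => selector r r a col (fun _ => 1) k x
  | .inr (.inl q) => selector r (2 * r) a col (fun i => a i q.2) q.1 x
  | .inr (.inr (.inl q)) => selector r (2 * r) a col (fun i => taylorCoeff n f (a i) q.2) q.1 x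
  | .inr (.inr (.inr j)) => x j

/-- The weight of the colour `k` in terms of the features. -/
def weight (k : K) (z : Feature D n K → ℝ) : ℝ := z (.inl k)

/-- The local approximation of the colour `k` in terms of the features. -/
noncomputable def localApprox (k : K) (z : Feature D n K → ℝ) : ℝ :=
  taylorSum (fun v => z (.inr (.inr (.inl (k, v))))) (fun j => z (.inr (.inl (k, j))))
    fun j => z (.inr (.inr (.inr j)))

variable {r : ℝ} {a : I → Fin D → ℝ} {col : I → K} {f : (Fin D → ℝ) → ℝ} {x : Fin D → ℝ}

/-- Where the weight of a colour is nonzero, its local approximation is exactly the Taylor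
polynomial at one of the centres, at distance less than `2 r`. -/
theorem localApprox_features (hr : 0 < r)
    (hsep : ∀ i i', col i = col i' → i ≠ i' → ∃ j, 6 * r ≤ |a i j - a i' j|) {k : K}
    (hk : weight k (features (n := n) r a col f x) ≠ 0) :
    ∃ i, (∀ j, |x j - a i j| < 2 * r) ∧
      localApprox k (features (n := n) r a col f x) =
        taylorSum (taylorCoeff n f (a i)) (a i) x := by
  obtain ⟨i, rfl, hi⟩ := exists_gate_ne_zero_of_selector_ne_zero hk
  have hx : ∀ j, |x j - a i j| < 2 * r := fun j =>
    (abs_sub_lt_of_gate_ne_zero hr hi j).trans_eq (two_mul r).symm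
  have hone : gate r (2 * r) (a i) x = 1 := gate_eq_one fun j => (hx j).le
  have hsel : ∀ v : I → ℝ, selector r (2 * r) a col v (col i) x = v i := fun v => by
    rw [selector_eq hr le_rfl hsep (by rw [hone]; exact one_ne_zero), hone, mul_one]
  refine ⟨i, hx, ?_⟩
  simp only [localApprox, features, hsel]

theorem weight_features_mem (hr : 0 < r)
    (hsep : ∀ i i', col i = col i' → i ≠ i' → ∃ j, 6 * r ≤ |a i j - a i' j|) (k : K) :
    0 ≤ weight k (features (n := n) r a col f x) ∧
      weight k (features (n := n) r a col f x) ≤ 1 := by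
  refine ⟨Finset.sum_nonneg fun i _ => mul_nonneg ?_ gate_nonneg, ?_⟩
  · split_ifs <;> norm_num
  · exact (le_abs_self _).trans
      (abs_selector_le hr (by linarith) hsep zero_le_one (fun _ => by simp) k)

theorem weight_features_eq_one (hr : 0 < r)
    (hsep : ∀ i i', col i = col i' → i ≠ i' → ∃ j, 6 * r ≤ |a i j - a i' j|) {i : I}
    (hi : ∀ j, |x j - a i j| ≤ r) : weight (col i) (features (n := n) r a col f x) = 1 := by
  have h1 : gate r r (a i) x = 1 := gate_eq_one hi
  have h2 : gate r (2 * r) (a i) x = 1 := gate_eq_one fun j => (hi j).trans (by linarith)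
  have := selector_eq (v := fun _ => (1 : ℝ)) (ρ := r) hr (by linarith) hsep
    (i₀ := i) (x := x) (by rw [h2]; exact one_ne_zero)
  rw [h1, mul_one] at this
  exact this

theorem abs_features_le (hr : 0 < r) (hr1 : ∀ j, |x j| ≤ 1)
    (hsep : ∀ i i', col i = col i' → i ≠ i' → ∃ j, 6 * r ≤ |a i j - a i' j|)
    (ha : ∀ i j, |a i j| ≤ 1) {V : ℝ} (hV : 0 ≤ V) (hf : ∀ v i, |taylorCoeff n f (a i) v| ≤ V)
    (o : Feature D n K) : |features (n := n) r a col f x o| ≤ V + 1 := by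
  rcases o with k | q | q | j
  · exact (abs_selector_le hr (by linarith) hsep zero_le_one (fun _ => by simp) k).trans
      (by linarith)
  · exact (abs_selector_le hr le_rfl hsep zero_le_one (fun i => ha i q.2) q.1).trans
      (by linarith)
  · exact (abs_selector_le hr le_rfl hsep hV (hf q.2) q.1).trans (by linarith)
  · exact (hr1 j).trans (by linarith)

theorem reluNet_features [Fintype K] {B V : ℝ} (hr : 0 < r) (hr1 : 2 * r ≤ 1) (hB : 2 ≤ B)
    (hrB : r⁻¹ ≤ B) (ha : ∀ i j, |a i j| ≤ 1) (hf : ∀ v i, |taylorCoeff n f (a i) v| ≤ V)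
    (hVB : V ≤ B) :
    ReluNet 2 (Fintype.card (Feature D n K) * ((6 * D + 2) * Fintype.card I + 64)) B
      (features (n := n) r a col f) := by
  have h : ∀ o : Feature D n K, ReluNet₁ 2 ((6 * D + 2) * Fintype.card I + 64) B
      fun x => features (n := n) r a col f x o := by
    rintro (k | q | q | j)
    · exact (reluNet_selector hr hB hrB hr.le (by linarith) ha (V := 1) (fun _ => by simp)
        (by linarith) k).mono (by linarith) le_rfl
    · exact (reluNet_selector hr hB hrB (by positivity) hr1 ha (fun i => ha i q.2)
        (by linarith) q.1).mono (by linarith) le_rfl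
    · exact (reluNet_selector hr hB hrB (by positivity) hr1 ha (hf q.2)
        hVB q.1).mono (by linarith) le_rfl
    · have h := (ReluNet₁.coord (B := B) j (a := 1) (c := 0) (by rw [abs_one]; linarith)
        (by rw [abs_zero]; linarith)).pad (by linarith) 2
      simp only [one_mul, add_zero, zero_add] at h
      refine h.mono ?_ le_rfl
      have : 0 ≤ (6 * (D : ℝ) + 2) * Fintype.card I := by positivity
      linarith
  refine ReluNet.mono (ReluNet.pi (by linarith) h) ?_ le_rfl
  rw [Finset.sum_const, Finset.card_univ, nsmul_eq_mul]

/-- On the cells of side `r` around the centres, a blend of the local approximations inherits the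
Taylor error at distance `2 r`. -/
theorem abs_blend_sub_le {β M : ℝ} (hβ : 0 < β) (hM : 0 ≤ M) (hf : f ∈ holderBall β D M)
    (hr : 0 < r) (hsep : ∀ i i', col i = col i' → i ≠ i' → ∃ j, 6 * r ≤ |a i j - a i' j|)
    (ha : ∀ i, a i ∈ cube D) (hx : x ∈ cube D) {i : I} (hi : ∀ j, |x j - a i j| ≤ r)
    {Q : (Feature D ⌊β⌋₊ K → ℝ) → ℝ} {U : Finset K} (hU : col i ∈ U)
    (hQ : ∀ (z : Feature D ⌊β⌋₊ K → ℝ) (y e : ℝ), (∀ k, 0 ≤ weight k z ∧ weight k z ≤ 1) →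
      (∀ k, weight k z ≠ 0 → |localApprox k z - y| ≤ e) → (∃ k ∈ U, weight k z = 1) →
        |Q z - y| ≤ e) :
    |Q (features r a col f x) - f x| ≤ (D : ℝ) ^ ⌊β⌋₊ * M * (2 * r) ^ β := by
  refine hQ _ _ _ (weight_features_mem hr hsep) (fun k hk => ?_)
    ⟨_, hU, weight_features_eq_one hr hsep hi⟩
  obtain ⟨i, hi, hP⟩ := localApprox_features hr hsep hk
  rw [hP, abs_sub_comm]
  refine (abs_sub_taylorSum_le hβ hM hf (ha i) hx).trans ?_
  have hnorm : ‖x - a i‖ ≤ 2 * r :=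
    (pi_norm_le_iff_of_nonneg (by positivity)).2 fun j => (hi j).le
  gcongr

end features

theorem netApprox_localApprox {D n : ℕ} {K : Type} [Fintype K] {η : ℝ} (hη : 0 < η) (k : K) :
    NetApprox η (localApprox (D := D) (n := n) k) := by
  unfold localApprox taylorSum
  exact NetApprox.sum hη.le _ fun v _ => (netApprox_coord hη.le _).mul hη
    (NetApprox.prod hη _ fun i _ => (netApprox_coord hη.le _).sub hη (netApprox_coord hη.le _))

/-- Distinct cells whose indices agree modulo `8` are at distance more than `7 r`. -/
theorem sub_le_of_same_color {D : ℕ} {r : ℝ} (hr : 0 < r) {x y : Fin D → ℝ}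
    (h : ∀ j, ((cellIndex r x j : ℤ) : ZMod 8) = cellIndex r y j)
    (hne : cellIndex r x ≠ cellIndex r y) : ∃ j, 6 * r ≤ |x j - y j| := by
  obtain ⟨j, hj⟩ := Function.ne_iff.1 hne
  refine ⟨j, ?_⟩
  have h1 : (8 : ℤ) ∣ cellIndex r x j - cellIndex r y j := by
    have := (ZMod.intCast_eq_intCast_iff_dvd_sub _ _ 8).1 (h j).symm
    exact_mod_cast this
  have h2 : (8 : ℤ) ≤ |cellIndex r x j - cellIndex r y j| :=
    Int.le_of_dvd (abs_pos.2 (sub_ne_zero.2 hj)) ((dvd_abs _ _).2 h1)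
  have := lt_abs_sub_of_cellIndex (k := 7) hr (by exact_mod_cast h2)
  push_cast at this
  linarith

/-- Hölder functions on a set that meets `O(r ^ (-d))` cells of side `r`, for `d > 0`: the lookup of
the features costs `O(r ^ (-d))` parameters with `r ≈ ε ^ (1 / β)`, the evaluation of the blended
Taylor polynomials up to `ε / 2` costs `O(ε ^ (-η))` parameters with `η = d / β`. -/
theorem exists_reluNet_holder_of_pos {D : ℕ} {β M d s : ℝ} (hβ : 0 < β) (hM : 0 ≤ M) (hd : 0 < d)
    {S : Set (Fin D → ℝ)} (hS : S ⊆ cube D)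
    (hcells : ∃ C : ℝ, 0 ≤ C ∧ ∀ r : ℝ, 0 < r → r ≤ 1 → ∃ Z : Finset (Fin D → ℤ),
      (Z.card : ℝ) ≤ C * r ^ (-d) ∧ (∀ x ∈ S, cellIndex r x ∈ Z) ∧
        ∀ z ∈ Z, ∃ x ∈ S, cellIndex r x = z)
    (hs : d / β + 1 / β ≤ s) :
    ∃ (L : ℕ) (C : ℝ), 0 ≤ C ∧ ∀ ε : ℝ, 0 < ε → ε ≤ 1 → ∀ f ∈ holderBall β D M,
      ∃ F : (Fin D → ℝ) → ℝ, ReluNet₁ L (C * ε ^ (-(d / β))) (C * ε ^ (-s)) F ∧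
        ∀ x ∈ S, |F x - f x| ≤ ε := by
  classical
  obtain ⟨CZ, hCZ, hcells⟩ := hcells
  set n := ⌊β⌋₊ with hn
  set η := d / β with hη
  have hη0 : 0 < η := by positivity
  have hβ' : 0 < 1 / β := by positivity
  set O := Feature D n (Fin D → ZMod 8) with hO
  obtain ⟨Q, hQ, hblend⟩ := exists_blend (ι := O) hη0 (K := Fin D → ZMod 8)
    (χ := weight) (P := localApprox) (fun k => netApprox_coord hη0.le _)
    (fun k => netApprox_localApprox hη0 k) Finset.univ
  obtain ⟨L, CQ, hQ⟩ := hQ (3 * M + 1)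
  have hCQ := hQ.nonneg
  set c₀ : ℝ := (D : ℝ) ^ n * M with hc₀
  have hc₀0 : 0 ≤ c₀ := by positivity
  set E : ℝ := 2 * (c₀ + 1) with hE
  have hE0 : 0 < E := by positivity
  set CB : ℝ := 2 + 2 * E ^ (1 / β) + 3 * M + CQ * 2 ^ η with hCB
  set A : ℝ := CZ * (2 ^ d * E ^ η) with hA
  set CW : ℝ := 2 * (Fintype.card O * ((6 * D + 2) * A + 64)) + 2 * (CQ * 2 ^ η) with hCW
  have hA0 : 0 ≤ A := by positivity
  have hCB0 : 0 ≤ CB := by positivity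
  have hCW0 : 0 ≤ CW := by positivity
  refine ⟨2 + L + 1, CW + CB, by positivity, fun ε h0 h1 f hf => ?_⟩
  -- the side of the cells balances the Taylor error against `ε / 2`
  set r : ℝ := (ε / E) ^ (1 / β) / 2 with hr_def
  have hεE : 0 < ε / E := by positivity
  have hεE1 : ε / E ≤ 1 := by
    rw [div_le_one hE0]; linarith
  have hr : 0 < r := by positivity
  have hr1 : 2 * r ≤ 1 := by
    rw [hr_def, mul_div_cancel₀ _ (two_ne_zero)]
    exact Real.rpow_le_one hεE.le hεE1 hβ'.le
  have hrβ : (2 * r) ^ β = ε / E := by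
    rw [hr_def, mul_div_cancel₀ _ (two_ne_zero), ← Real.rpow_mul hεE.le,
      one_div_mul_cancel hβ.ne', Real.rpow_one]
  have hε1 : 1 ≤ ε ^ (-s) := one_le_rpow_neg h0 h1 (by linarith)
  have hεη1 : 1 ≤ ε ^ (-η) := one_le_rpow_neg h0 h1 hη0.le
  have hεη : ε ^ (-η) ≤ ε ^ (-s) := Real.rpow_le_rpow_of_exponent_ge h0 h1 (by linarith)
  have hεβ : ε ^ (-(1 / β)) ≤ ε ^ (-s) := Real.rpow_le_rpow_of_exponent_ge h0 h1 (by linarith)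
  have hrinv : r⁻¹ = 2 * (E ^ (1 / β) * ε ^ (-(1 / β))) := by
    rw [← div_rpow_neg h0 hE0, Real.rpow_neg hεE.le, hr_def, inv_div, div_eq_mul_inv]
  have hrd : r ^ (-d) = 2 ^ d * E ^ η * ε ^ (-η) := by
    rw [hr_def, div_rpow_neg (by positivity) two_pos, ← Real.rpow_mul hεE.le, mul_assoc,
      ← div_rpow_neg h0 hE0]
    congr 2
    rw [hη]
    ring
  obtain ⟨Z, hZ, hmem, hrep⟩ := hcells r hr (by linarith)
  choose! a₀ ha₀S ha₀ using hrep
  set a : Z → Fin D → ℝ := fun z => a₀ z with ha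
  set col : Z → Fin D → ZMod 8 := fun z j => (z.1 j : ZMod 8) with hcol
  have haS : ∀ z, a z ∈ S := fun z => ha₀S z z.2
  have hcell : ∀ z, cellIndex r (a z) = z.1 := fun z => ha₀ z z.2
  have hsep : ∀ i i', col i = col i' → i ≠ i' → ∃ j, 6 * r ≤ |a i j - a i' j| := by
    intro i i' hc hne
    refine sub_le_of_same_color hr (fun j => ?_) ?_
    · rw [hcell, hcell]; exact congrFun hc j
    · rw [hcell, hcell]; exact fun h => hne (Subtype.ext h)
  have ha1 : ∀ i j, |a i j| ≤ 1 := fun i j => abs_le_one_of_mem_cube (hS (haS i)) j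
  have hcoef : ∀ v i, |taylorCoeff n f (a i) v| ≤ 3 * M := fun v i =>
    abs_taylorCoeff_le hβ hM hf (hS (haS i)) v
  have hQf : ∀ x ∈ S, |Q (features (n := n) r a col f x) - f x| ≤ ε / 2 := by
    intro x hx
    have hi : ∀ j, |x j - a ⟨cellIndex r x, hmem x hx⟩ j| ≤ r := fun j =>
      (abs_sub_lt_of_cellIndex_eq hr (hcell ⟨cellIndex r x, hmem x hx⟩).symm j).le
    refine (abs_blend_sub_le hβ hM hf hr hsep (fun i => hS (haS i)) (hS hx) hi
      (Finset.mem_univ _) hblend).trans ?_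
    rw [hrβ, ← hn, ← hc₀, hE, mul_div_assoc', div_le_iff₀ (by positivity)]
    linarith
  obtain ⟨φ, hφ, hφ'⟩ := hQ.2 (ε / 2) (by positivity) (by linarith)
  rw [div_rpow_neg h0 two_pos] at hφ
  clear hblend hQ
  set B : ℝ := (CW + CB) * ε ^ (-s) with hB
  have hBexp : B = CW * ε ^ (-s) + (2 * ε ^ (-s) + 2 * (E ^ (1 / β) * ε ^ (-s)) +
      3 * (M * ε ^ (-s)) + CQ * 2 ^ η * ε ^ (-s)) := by
    rw [hB, hCB]; ring
  have p1 : 0 ≤ CW * ε ^ (-s) := by positivity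
  have p2 : E ^ (1 / β) * ε ^ (-(1 / β)) ≤ E ^ (1 / β) * ε ^ (-s) := by gcongr
  have p3 : M ≤ M * ε ^ (-s) := le_mul_of_one_le_right hM hε1
  have p4 : CQ * 2 ^ η * ε ^ (-η) ≤ CQ * 2 ^ η * ε ^ (-s) := by gcongr
  have p5 : 0 ≤ E ^ (1 / β) * ε ^ (-(1 / β)) := by positivity
  have p6 : 0 ≤ CQ * 2 ^ η * ε ^ (-η) := by positivity
  have hB2 : 2 ≤ B := by linarith
  have hBM : 3 * M ≤ B := by linarith
  have hBr : r⁻¹ ≤ B := by linarith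
  have hBQ : CQ * (2 ^ η * ε ^ (-η)) ≤ B := by linarith
  have hnet := (hφ.mono le_rfl hBQ).comp
    (reluNet_features (n := n) (col := col) hr hr1 hB2 hBr ha1 hcoef hBM)
  refine ⟨_, ReluNet.mono hnet ?_ le_rfl, fun x hx => ?_⟩
  · have hcard : (Fintype.card Z : ℝ) ≤ A * ε ^ (-η) := by
      rw [Fintype.card_coe, hA]
      refine hZ.trans_eq ?_
      rw [hrd]; ring
    have hVle : (6 * D + 2) * (Fintype.card Z : ℝ) + 64 ≤ ((6 * D + 2) * A + 64) * ε ^ (-η) := by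
      have : (6 * (D : ℝ) + 2) * Fintype.card Z ≤ (6 * D + 2) * (A * ε ^ (-η)) := by gcongr
      linarith
    calc 2 * (Fintype.card O * ((6 * D + 2) * (Fintype.card Z : ℝ) + 64)) +
          2 * (CQ * (2 ^ η * ε ^ (-η)))
        ≤ 2 * (Fintype.card O * (((6 * D + 2) * A + 64) * ε ^ (-η))) +
          2 * (CQ * (2 ^ η * ε ^ (-η))) := by gcongr
      _ = CW * ε ^ (-η) := by rw [hCW]; ring
      _ ≤ (CW + CB) * ε ^ (-η) := by gcongr; linarith
  · have e1 := hφ' (features (n := n) r a col f x) fun o =>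
      abs_features_le hr (abs_le_one_of_mem_cube (hS hx)) hsep ha1 (by positivity) hcoef o
    have e2 := hQf x hx
    exact (abs_sub_le _ (Q (features (n := n) r a col f x)) _).trans (by linarith)

/-- In dimension zero the set is finite, and networks of constant size interpolate exactly. -/
theorem exists_reluNet_holder_of_finite {D : ℕ} {β M : ℝ} (hβ : 0 < β) (hM : 0 ≤ M)
    {S : Set (Fin D → ℝ)} (hS : S ⊆ cube D) (hfin : S.Finite) :
    ∃ (L : ℕ) (C : ℝ), 0 ≤ C ∧ ∀ f ∈ holderBall β D M,
      ∃ F : (Fin D → ℝ) → ℝ, ReluNet₁ L C C F ∧ ∀ x ∈ S, F x = f x := by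
  classical
  obtain ⟨r, hr, hr1, hsep⟩ := exists_separation hfin.toFinset
  set Z := hfin.toFinset with hZ
  have hZS : ∀ i : Z, i.1 ∈ cube D := fun i => hS (hfin.mem_toFinset.1 i.2)
  set B : ℝ := 2 + r⁻¹ + M with hB
  have hrinv : 0 ≤ r⁻¹ := by positivity
  have hW : 0 ≤ (6 * (D : ℝ) + 2) * Fintype.card Z + 1 := by positivity
  refine ⟨2, (6 * D + 2) * Fintype.card Z + 1 + B, by positivity, fun f hf =>
    ⟨fun x => ∑ i : Z, f i * gate r 0 i x, ?_, fun x hx => ?_⟩⟩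
  · exact (reluNet_sum_gate (B := B) (a := fun i : Z => i.1) (v := fun i => f i) hr (by linarith)
      (by linarith) le_rfl zero_le_one (fun i j => abs_le_one_of_mem_cube (hZS i) j)
      fun i => (abs_le_of_mem_holderBall hβ hM hf (hZS i)).trans (by linarith)).mono
        (by linarith) (by linarith)
  · have hxZ : x ∈ Z := hfin.mem_toFinset.2 hx
    dsimp only
    rw [Finset.sum_eq_single (⟨x, hxZ⟩ : Z)]
    · rw [gate_eq_one (fun j => by simp), mul_one]
    · intro i _ hi
      obtain ⟨j, hj⟩ := hsep x hxZ i.1 i.2 fun h => hi (Subtype.ext h.symm)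
      rw [gate_eq_zero hr (j := j) (by linarith), mul_zero]
    · simp

/-- Approximation of Hölder functions on a set of upper Minkowski dimension at most `d`, at bounded
depth. The depth and the constant do not depend on the function. -/
theorem exists_reluNet_holder {D : ℕ} {β M s : ℝ} {d : ℝ≥0} (hβ : 0 < β) (hM : 0 ≤ M)
    {S : Set (Fin D → ℝ)} (hS : S ⊆ cube D) (hdim : upperMinkowskiDim S ≤ (d : ℝ≥0∞))
    (hcrit : upperMinkowskiDim S = (d : ℝ≥0∞) →
      limsup (coverMass S d) (𝓝[>] (0 : ℝ≥0)) < ⊤)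
    (hs : d / β + 1 / β ≤ s) :
    ∃ (L : ℕ) (C : ℝ), 0 ≤ C ∧ ∀ ε : ℝ, 0 < ε → ε ≤ 1 → ∀ f ∈ holderBall β D M,
      ∃ F : (Fin D → ℝ) → ℝ, ReluNet₁ L (C * ε ^ (-(d / β))) (C * ε ^ (-s)) F ∧
        ∀ x ∈ S, |F x - f x| ≤ ε := by
  have hcells := exists_cells (exists_cover_bound hdim hcrit)
  rcases eq_or_ne d 0 with rfl | hd
  · obtain ⟨C, -, hC⟩ := hcells
    have hfin : S.Finite := finite_of_cells (C := C) fun r hr hr1 => by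
      obtain ⟨Z, hZ, hmem, -⟩ := hC r hr hr1
      exact ⟨Z, by simpa using hZ, hmem⟩
    obtain ⟨L, C', hC', h⟩ := exists_reluNet_holder_of_finite hβ hM hS hfin
    refine ⟨L, C', hC', fun ε h0 h1 f hf => ?_⟩
    obtain ⟨F, hF, hFf⟩ := h f hf
    have hs0 : 0 ≤ s := le_trans (by positivity) hs
    refine ⟨F, hF.mono (by simp) (le_mul_of_one_le_right hC' (one_le_rpow_neg h0 h1 hs0)),
      fun x hx => ?_⟩
    rw [hFf x hx, sub_self, abs_zero]
    exact h0.le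
  · exact exists_reluNet_holder_of_pos hβ hM (by positivity) hS hcells hs

/-! ### Two-tower models -/

/-- Truncation to `[-R, R]`, written with the positive part. -/
noncomputable def clip (R y : ℝ) : ℝ := max (y + R) 0 - max (y - R) 0 - R

theorem abs_clip_le {R : ℝ} (hR : 0 ≤ R) (y : ℝ) : |clip R y| ≤ R := by
  unfold clip
  rw [abs_le]
  rcases max_cases (y + R) 0 with h | h <;> rcases max_cases (y - R) 0 with h' | h' <;>
    constructor <;> linarith

theorem abs_clip_sub_le {R y t : ℝ} (ht : |t| ≤ R) : |clip R y - t| ≤ |y - t| := by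
  unfold clip
  obtain ⟨h1, h2⟩ := abs_le.1 ht
  rcases max_cases (y + R) 0 with h | h <;> rcases max_cases (y - R) 0 with h' | h' <;>
    rw [h.1, h'.1] <;> rcases abs_cases (y - t) with ⟨e, _⟩ | ⟨e, _⟩ <;> rw [e, abs_le] <;>
    constructor <;> linarith

theorem ReluNet₁.clip {ι : Type} [Fintype ι] {L : ℕ} {W B R : ℝ} {f : (ι → ℝ) → ℝ}
    (h : ReluNet₁ L W B f) (hB : 1 ≤ B) (hR : 0 ≤ R) (hRB : R ≤ B) :
    ReluNet₁ (L + 2) (4 * W + 11) B fun x => clip R (f x) := by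
  have shift : ∀ s : ℝ, |s| = 1 → ReluNet₁ (L + 1) (2 * W + 4) B fun x => f x + s * R := by
    intro s hs
    have := ReluNet₁.affine (I := Unit) (by linarith) (fun _ => h) (a := fun _ => 1) (c := s * R)
      (fun _ => by rwa [abs_one]) (by rwa [abs_mul, hs, one_mul, abs_of_nonneg hR])
    simp only [Finset.univ_unique, one_mul, Finset.sum_const, Finset.card_singleton, one_smul,
      Fintype.card_unit] at this
    exact this.mono (by push_cast; linarith) le_rfl
  have := ReluNet₁.relu (I := Fin 2) (by linarith)
    (f := fun i x => f x + (![1, -1] : Fin 2 → ℝ) i * R)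
    (fun i => shift _ (by fin_cases i <;> simp)) (a := ![1, -1]) (c := -R)
    (fun i => by fin_cases i <;> simpa using hB) (by rwa [abs_neg, abs_of_nonneg hR])
  simp only [Fin.sum_univ_two, Matrix.cons_val_zero, Matrix.cons_val_one,
    Matrix.cons_val_fin_one, Fintype.card_fin] at this
  have e : (fun x => TwoTower.clip R (f x)) = fun x =>
      1 * max (f x + 1 * R) 0 + -1 * max (f x + -1 * R) 0 + -R := by
    funext x
    rw [TwoTower.clip, one_mul, one_mul, neg_one_mul, neg_one_mul]
    ring_nf
  rw [e]
  exact this.mono (by push_cast; linarith) le_rfl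

/-- One tower: all coordinates of a Hölder map are approximated on a set of upper Minkowski
dimension at most `d`, for all errors up to a fixed bound `E`. -/
theorem exists_netClass {D : ℕ} (p : ℕ) {β M s : ℝ} {d : ℝ≥0} (hβ : 0 < β) (hM : 0 ≤ M)
    {S : Set (Fin D → ℝ)} (hS : S ⊆ cube D) (hdim : upperMinkowskiDim S ≤ (d : ℝ≥0∞))
    (hcrit : upperMinkowskiDim S = (d : ℝ≥0∞) →
      limsup (coverMass S d) (𝓝[>] (0 : ℝ≥0)) < ⊤)
    (hs : d / β + 1 / β ≤ s) (E : ℝ) :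
    ∃ (L : ℕ) (C : ℝ), 1 ≤ L ∧ 0 ≤ C ∧ ∀ ε : ℝ, 0 < ε → ε ≤ E → ∃ (W : ℕ) (B : ℝ),
      (W : ℝ) ≤ C * ε ^ (-(d : ℝ) / β) ∧ B ≤ C * ε ^ (-s) ∧
        ∀ fstar : (Fin D → ℝ) → (Fin p → ℝ), (∀ j, (fun x => fstar x j) ∈ holderBall β D M) →
          ∃ f ∈ netClass D p W L B M, ∀ x ∈ S, ∀ j, |f x j - fstar x j| ≤ ε := by
  obtain ⟨L, C, hC, h⟩ := exists_reluNet_holder hβ hM hS hdim hcrit hs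
  set E₁ : ℝ := max 1 E
  have hE₁ : 1 ≤ E₁ := le_max_left _ _
  have hE₁0 : 0 < E₁ := by linarith
  set η : ℝ := d / β with hη
  have hη0 : 0 ≤ η := by positivity
  have hs0 : 0 ≤ s := le_trans (by positivity) hs
  refine ⟨L + 3, p * (4 * C + 11) * E₁ ^ η + (C + 2 * M + 1) * E₁ ^ s, by omega, by positivity,
    fun ε h0 hεE => ?_⟩
  -- passing to `ε / E₁ ≤ 1` only changes the constants
  have hε0 : 0 < ε / E₁ := by positivity
  have hε1 : ε / E₁ ≤ 1 := (div_le_one hE₁0).2 (hεE.trans (le_max_right _ _))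
  have hεε : ε / E₁ ≤ ε := div_le_self h0.le hE₁
  have hr1 := one_le_rpow_neg hε0 hε1 hη0
  have hr2 := one_le_rpow_neg hε0 hε1 hs0
  set W₀ : ℝ := p * (4 * (C * (ε / E₁) ^ (-η)) + 11) with hW₀
  set B : ℝ := (C + 2 * M + 1) * (ε / E₁) ^ (-s) with hB
  have hW₀0 : 0 ≤ W₀ := by positivity
  have hB1 : 1 ≤ B := by
    rw [hB]
    exact one_le_mul_of_one_le_of_one_le (by linarith) hr2
  have hBM : 2 * M ≤ B := by
    rw [hB]
    exact le_trans (by linarith) (le_mul_of_one_le_right (by positivity) hr2)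
  have hBC : C * (ε / E₁) ^ (-s) ≤ B := by
    rw [hB]
    gcongr
    linarith
  refine ⟨⌊W₀⌋₊, B, (Nat.floor_le hW₀0).trans ?_, ?_, fun fstar hf => ?_⟩
  · rw [neg_div, add_mul, ← hη]
    have e1 : 0 ≤ (C + 2 * M + 1) * E₁ ^ s * ε ^ (-η) := by positivity
    have e2 : W₀ ≤ p * ((4 * C + 11) * (ε / E₁) ^ (-η)) := by
      rw [hW₀]
      gcongr
      linarith
    rw [div_rpow_neg h0 hE₁0] at e2
    linarith
  · rw [hB, div_rpow_neg h0 hE₁0, add_mul, ← mul_assoc]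
    have : 0 ≤ p * (4 * C + 11) * E₁ ^ η * ε ^ (-s) := by positivity
    linarith
  · choose F hF hFf using fun j => h (ε / E₁) hε0 hε1 _ (hf j)
    have hclip : ∀ j, ReluNet₁ (L + 2) (4 * (C * (ε / E₁) ^ (-η)) + 11) B
        fun x => clip (2 * M) (F j x) := fun j =>
      ((hF j).mono le_rfl hBC).clip hB1 (by positivity) hBM
    obtain ⟨Θ, h1, h2, h3, h4⟩ := (ReluNet.pi (by linarith) hclip).exists_net (by linarith)
      (Equiv.refl (Fin p))
    have heval : ∀ x j, Θ.eval x j = clip (2 * M) (F j x) := h1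
    refine ⟨Θ.eval, ⟨Θ, rfl, ?_, h3.le, h4, fun x _ j => ?_⟩, fun x hx j => ?_⟩
    · refine Nat.le_floor (h2.trans_eq ?_)
      simp [hW₀, mul_add]
    · rw [heval]
      exact abs_clip_le (by positivity) _
    · rw [heval]
      have hb := abs_le_of_mem_holderBall hβ hM (hf j) (hS hx)
      exact (abs_clip_sub_le (hb.trans (by linarith))).trans ((hFf j x hx).trans hεε)

theorem zero_mem_netClass (D p : ℕ) {L : ℕ} (hL : 1 ≤ L) {M : ℝ} (hM : 0 ≤ M) :
    (0 : (Fin D → ℝ) → (Fin p → ℝ)) ∈ netClass D p 0 L 0 M := by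
  refine ⟨.last 0 0, ?_, ?_, hL, ?_, fun x _ j => ?_⟩
  · funext x
    simp [Net.eval]
  · simp [Net.size, Net.layerSize]
  · exact layerScale_of_le (A := 0) (b := 0) le_rfl ⟨by simp, by simp⟩
  · simpa using hM

theorem fst_mem_support {X Y : Type*} [TopologicalSpace X] [TopologicalSpace Y]
    [MeasurableSpace X] [MeasurableSpace Y] {μ : Measure (X × Y)} {z : X × Y}
    (hz : z ∈ μ.support) : z.1 ∈ μ.fst.support := by
  rw [Measure.mem_support_iff_forall] at hz ⊢
  exact fun U hU => (hz _ (continuous_fst.continuousAt hU)).trans_le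
    (Measure.le_map_apply measurable_fst.aemeasurable U)

theorem snd_mem_support {X Y : Type*} [TopologicalSpace X] [TopologicalSpace Y]
    [MeasurableSpace X] [MeasurableSpace Y] {μ : Measure (X × Y)} {z : X × Y}
    (hz : z ∈ μ.support) : z.2 ∈ μ.snd.support := by
  rw [Measure.mem_support_iff_forall] at hz ⊢
  exact fun U hU => (hz _ (continuous_snd.continuousAt hU)).trans_le
    (Measure.le_map_apply measurable_snd.aemeasurable U)

/-- If `|b| ≤ M` and `|a'| ≤ 2 M`, then coordinatewise errors `ε` give an error `3 p M ε` of the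
scalar product `∑ j, a j * b j`. -/
theorem abs_sum_mul_sub_le {p : ℕ} {M ε : ℝ} (hM : 0 ≤ M) {a b a' b' : Fin p → ℝ}
    (ha : ∀ j, |a' j - a j| ≤ ε) (hb : ∀ j, |b' j - b j| ≤ ε) (hbM : ∀ j, |b j| ≤ M)
    (haM : ∀ j, |a' j| ≤ 2 * M) :
    |∑ j, a' j * b' j - ∑ j, a j * b j| ≤ 3 * p * M * ε := by
  rw [← Finset.sum_sub_distrib]
  calc |∑ j, (a' j * b' j - a j * b j)| ≤ ∑ j, |a' j * b' j - a j * b j| :=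
        Finset.abs_sum_le_sum_abs _ _
    _ ≤ ∑ _j : Fin p, 3 * M * ε := Finset.sum_le_sum fun j _ => by
        have e : a' j * b' j - a j * b j = a' j * (b' j - b j) + (a' j - a j) * b j := by ring
        have h1 : |a' j * (b' j - b j)| ≤ 2 * M * ε := by
          rw [abs_mul]
          exact mul_le_mul (haM j) (hb j) (abs_nonneg _) (by positivity)
        have h2 : |(a' j - a j) * b j| ≤ ε * M := by
          rw [abs_mul]
          exact mul_le_mul (ha j) (hbM j) (abs_nonneg _) ((abs_nonneg _).trans (ha j))
        rw [e]
        exact (abs_add_le _ _).trans (by linarith)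
    _ = 3 * p * M * ε := by simp; ring

theorem iInf_supNorm_le {Du Di p W L W' L' : ℕ} {B M B' δ : ℝ}
    {μ : Measure ((Fin Du → ℝ) × (Fin Di → ℝ))} {g : (Fin Du → ℝ) × (Fin Di → ℝ) → ℝ}
    {f : (Fin Du → ℝ) → (Fin p → ℝ)} {f' : (Fin Di → ℝ) → (Fin p → ℝ)}
    (hf : f ∈ netClass Du p W L B M) (hf' : f' ∈ netClass Di p W' L' B' M)
    (h : ∀ z ∈ μ.support, |pairing f f' z - g z| ≤ δ) :
    ⨅ R ∈ twoTowerClass Du Di p W L B M W' L' B', supNorm μ (fun z => R z - g z) ≤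
      ENNReal.ofReal δ :=
  iInf₂_le_of_le (pairing f f') ⟨f, hf, f', hf', rfl⟩
    (iSup₂_le fun z hz => ENNReal.ofReal_le_ofReal (h z hz))

end TwoTower

theorem theorem1 (p Du Di : ℕ) (β M : ℝ) (hβ : 0 < β) (hM : 0 ≤ M) (du di : ℝ≥0)
    -- the laws of the user covariates, of the item covariates, and of the pair
    (μu : Measure (Fin Du → ℝ)) (μi : Measure (Fin Di → ℝ))
    (μui : Measure ((Fin Du → ℝ) × (Fin Di → ℝ)))
    [IsProbabilityMeasure μu] [IsProbabilityMeasure μi] [IsProbabilityMeasure μui]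
    (hu : μui.fst = μu) (hi : μui.snd = μi)
    (hu_cube : μu.support ⊆ TwoTower.cube Du) (hi_cube : μi.support ⊆ TwoTower.cube Di)
    (hu_dim : TwoTower.upperMinkowskiDim μu.support ≤ (du : ℝ≥0∞))
    (hi_dim : TwoTower.upperMinkowskiDim μi.support ≤ (di : ℝ≥0∞))
    -- in the critical case of equality, finite upper Minkowski content: `N(r) = O(r ^ (-d))`
    (hu_crit : TwoTower.upperMinkowskiDim μu.support = (du : ℝ≥0∞) →
      limsup (TwoTower.coverMass μu.support du) (𝓝[>] (0 : ℝ≥0)) < ⊤)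
    (hi_crit : TwoTower.upperMinkowskiDim μi.support = (di : ℝ≥0∞) →
      limsup (TwoTower.coverMass μi.support di) (𝓝[>] (0 : ℝ≥0)) < ⊤) :
    ∃ (C s : ℝ) (L L' : ℕ), 0 < s ∧ ∀ ε : ℝ, 0 < ε →
      ∃ (W W' : ℕ) (B B' : ℝ),
        (W : ℝ) ≤ C * ε ^ (-(du : ℝ) / β) ∧ (W' : ℝ) ≤ C * ε ^ (-(di : ℝ) / β) ∧
        B ≤ C * ε ^ (-s) ∧ B' ≤ C * ε ^ (-s) ∧
        ∀ (fstar : (Fin Du → ℝ) → (Fin p → ℝ)) (fstar' : (Fin Di → ℝ) → (Fin p → ℝ)),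
          (∀ j, (fun x => fstar x j) ∈ TwoTower.holderBall β Du M) →
          (∀ j, (fun x => fstar' x j) ∈ TwoTower.holderBall β Di M) →
          ⨅ R ∈ TwoTower.twoTowerClass Du Di p W L B M W' L' B',
              TwoTower.supNorm μui (fun z => R z - TwoTower.pairing fstar fstar' z)
            ≤ ENNReal.ofReal (3 * (p : ℝ) * M * ε) := by
  have hM3 : 0 ≤ M / 3 := by positivity
  set s : ℝ := max ((du : ℝ) / β + 1 / β) ((di : ℝ) / β + 1 / β)
  have hβ' : 0 < 1 / β := by positivity
  have hs : 0 < s := lt_of_lt_of_le (by positivity) (le_max_left _ _)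
  obtain ⟨L, C, hL, hC, hU⟩ := TwoTower.exists_netClass p hβ hM hu_cube hu_dim hu_crit
    (s := s) (le_max_left _ _) (M / 3)
  obtain ⟨L', C', hL', hC', hI⟩ := TwoTower.exists_netClass p hβ hM hi_cube hi_dim hi_crit
    (s := s) (le_max_right _ _) (M / 3)
  have hsu : ∀ z ∈ μui.support, z.1 ∈ μu.support := fun z hz => hu ▸ TwoTower.fst_mem_support hz
  have hsi : ∀ z ∈ μui.support, z.2 ∈ μi.support := fun z hz => hi ▸ TwoTower.snd_mem_support hz
  refine ⟨max C C', s, L, L', hs, fun ε hε => ?_⟩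
  have hCmax : 0 ≤ max C C' := hC.trans (le_max_left _ _)
  rcases le_or_gt ε (M / 3) with hle | hgt
  · obtain ⟨W, B, hW, hB, hf⟩ := hU ε hε hle
    obtain ⟨W', B', hW', hB', hf'⟩ := hI ε hε hle
    refine ⟨W, W', B, B', hW.trans (by gcongr; exact le_max_left _ _),
      hW'.trans (by gcongr; exact le_max_right _ _), hB.trans (by gcongr; exact le_max_left _ _),
      hB'.trans (by gcongr; exact le_max_right _ _), fun fstar fstar' h h' => ?_⟩
    obtain ⟨f, hfc, hfe⟩ := hf fstar h
    obtain ⟨f', hfc', hfe'⟩ := hf' fstar' h'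
    refine TwoTower.iInf_supNorm_le hfc hfc' fun z hz => ?_
    obtain ⟨-, -, -, -, -, hbd⟩ := hfc
    exact TwoTower.abs_sum_mul_sub_le hM (hfe _ (hsu z hz)) (hfe' _ (hsi z hz))
      (fun j => TwoTower.abs_le_of_mem_holderBall hβ hM (h' j) (hi_cube (hsi z hz)))
      (hbd _ (hu_cube (hsu z hz)))
  · -- for `ε > M / 3` the size bound may force empty networks, and the zero function suffices
    refine ⟨0, 0, 0, 0, by rw [Nat.cast_zero]; positivity, by rw [Nat.cast_zero]; positivity,
      by positivity, by positivity, fun fstar fstar' h h' => ?_⟩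
    refine TwoTower.iInf_supNorm_le (TwoTower.zero_mem_netClass Du p hL hM)
      (TwoTower.zero_mem_netClass Di p hL' hM) fun z hz => ?_
    have h0 : TwoTower.pairing (0 : (Fin Du → ℝ) → Fin p → ℝ) (0 : (Fin Di → ℝ) → Fin p → ℝ) z =
        0 := by simp [TwoTower.pairing]
    rw [h0, zero_sub, abs_neg, TwoTower.pairing]
    calc |∑ j, fstar z.1 j * fstar' z.2 j| ≤ ∑ j, |fstar z.1 j * fstar' z.2 j| :=
          Finset.abs_sum_le_sum_abs _ _
      _ ≤ ∑ _j : Fin p, M * M := Finset.sum_le_sum fun j _ => by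
          rw [abs_mul]
          exact mul_le_mul
            (TwoTower.abs_le_of_mem_holderBall hβ hM (h j) (hu_cube (hsu z hz)))
            (TwoTower.abs_le_of_mem_holderBall hβ hM (h' j) (hi_cube (hsi z hz)))
            (abs_nonneg _) hM
      _ = p * M * M := by simp; ring
      _ ≤ p * M * (3 * ε) := by gcongr; linarith
      _ = 3 * p * M * ε := by ring
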